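/- Let $K$ be a field and let $I\neq 0$ be a squarefree monomial ideal of $S=K[x_1,\dots,x_n]$ whose minimal monomial generators $f_1,\dots,f_m$ all have the same degree $d\ge 1$. Let $R=K[x_1,\dots,x_n,y_1,\dots,y_m]$, let $M$ be the highest exponent with which a variable occurs in $f_1,\dots,f_m$ (so $M=1$), and let $$\mathrm{LIN}(I)=\big(x_1^{a_1}\cdots x_n^{a_n}\mid a_1+\dots+a_n=d,\ a_k\le M\text{ for all }k\big)+\big(f_jy_j/x_k\mid 1\le j\le m,\ 1\le k\le n,\ x_k\text{ divides }f_j\big)\subseteq R .$$ A $(d-1)$-edge of $I$ is a squarefree monomial of degree $d-1$ in $S$ that divides some $f_j$. A $j$-cluster is a set of exactly $j$ of the generators $f_1,\dots,f_m$ that are all divisible by a same $(d-1)$-edge, and $C_j$ denotes the number of $j$-clusters that are not contained in a $(j+1)$-cluster. Let $\beta_i(\mathrm{LIN}(I))$ be the $i$-th total Betti number, that is, the rank of the $i$-th module $F_i$ in a minimal graded free resolution $\cdots\to F_1\to F_0\to \mathrm{LIN}(I)\to 0$ over $R$ with its standard grading. Then for all $i\ge 0$ $$\beta_i\big(\mathrm{LIN}(I)\big)=\binom{i+d-1}{d-1}\binom{n}{i+d}+\binom{n-d+1}{i}\Big(md-\sum_{j\ge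 2}(j-1)C_j\Big)+\sum_{j\ge 2}C_j\sum_{k=2}^{j}\binom{n-d+k}{i}.$$ -/

import Mathlib

open MvPolynomial

noncomputable section

namespace StarLinearization

/-! ### Monomial ideals. A monomial is represented by its exponent vector; divisibility of
monomials is then the pointwise order on exponent vectors. -/

/-- An ideal generated by a set of monomials. -/
def IsMonomialIdeal {σ K : Type*} [Field K] (I : Ideal (MvPolynomial σ K)) : Prop :=
  ∃ S : Set (σ →₀ ℕ), I = Ideal.span ((fun s => monomial s (1 : K)) '' S)

/-- `G(I)`: the monomials in `I` that are minimal with respect to divisibility. -/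
def minGens {σ K : Type*} [Field K] (I : Ideal (MvPolynomial σ K)) : Set (σ →₀ ℕ) :=
  {s | Minimal (fun t : σ →₀ ℕ => monomial t (1 : K) ∈ I) s}

/-- A squarefree monomial. -/
def IsSquarefreeMonomial {σ : Type*} (s : σ →₀ ℕ) : Prop := ∀ k, s k ≤ 1

/-! ### The `*`-linearization -/

/-- The highest exponent with which a variable occurs in one of the monomials `f j`. -/
def maxExponent {n m : ℕ} (f : Fin m → (Fin n →₀ ℕ)) : ℕ :=
  Finset.univ.sup fun j => Finset.univ.sup fun k => f j k

/-- The complete part: all monomials of degree `d` in `x₁, …, xₙ` with exponents at most `M`.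
In `Fin n ⊕ Fin m`, `Sum.inl k` is the variable `x_k` and `Sum.inr j` the variable `y_j`. -/
def completePart (K : Type*) [Field K] {n m : ℕ} (d : ℕ) (f : Fin m → (Fin n →₀ ℕ)) :
    Ideal (MvPolynomial (Fin n ⊕ Fin m) K) :=
  Ideal.span {p | ∃ a : Fin n →₀ ℕ, a.degree = d ∧ (∀ k, a k ≤ maxExponent f) ∧
    p = monomial (a.mapDomain Sum.inl) 1}

/-- The last part: the monomials `f_j y_j / x_k` with `x_k` dividing `f_j`. -/
def lastPart (K : Type*) [Field K] {n m : ℕ} (f : Fin m → (Fin n →₀ ℕ)) :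
    Ideal (MvPolynomial (Fin n ⊕ Fin m) K) :=
  Ideal.span {p | ∃ (j : Fin m) (k : Fin n), k ∈ (f j).support ∧
    p = monomial ((f j - Finsupp.single k 1).mapDomain Sum.inl +
      Finsupp.single (Sum.inr j) 1) 1}

/-- The `*`-linearization, in `K[x₁, …, xₙ, y₁, …, yₘ]`, of the ideal with minimal monomial
generators `f 0, …, f (m - 1)`, all of degree `d`. -/
def LIN (K : Type*) [Field K] {n m : ℕ} (d : ℕ) (f : Fin m → (Fin n →₀ ℕ)) :
    Ideal (MvPolynomial (Fin n ⊕ Fin m) K) :=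
  completePart K d f ⊔ lastPart K f

/-! ### Clusters -/

/-- A `(d-1)`-edge of `I`: a squarefree monomial of degree `d - 1` that divides a generator. -/
def IsEdge {n : ℕ} {K : Type*} [Field K] (I : Ideal (MvPolynomial (Fin n) K)) (d : ℕ)
    (u : Fin n →₀ ℕ) : Prop :=
  IsSquarefreeMonomial u ∧ u.degree + 1 = d ∧ ∃ s ∈ minGens I, u ≤ s

/-- A `j`-cluster: a set of `j` generators of `I` all divided by a same `(d-1)`-edge. -/
def IsCluster {n : ℕ} {K : Type*} [Field K] (I : Ideal (MvPolynomial (Fin n) K)) (d j : ℕ)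
    (A : Finset (Fin n →₀ ℕ)) : Prop :=
  (A : Set (Fin n →₀ ℕ)) ⊆ minGens I ∧ A.card = j ∧ ∃ u, IsEdge I d u ∧ ∀ s ∈ A, u ≤ s

/-- `C_j`: the number of `j`-clusters that are not contained in a `(j+1)`-cluster. -/
def numMaxClusters {n : ℕ} {K : Type*} [Field K] (I : Ideal (MvPolynomial (Fin n) K))
    (d j : ℕ) : ℕ :=
  {A : Finset (Fin n →₀ ℕ) | IsCluster I d j A ∧
    ¬ ∃ B, IsCluster I d (j + 1) B ∧ A ⊆ B}.ncard

/-! ### Minimal graded free resolutions and Betti numbers -/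

/-- A minimal graded free resolution `⋯ → F₁ → F₀ → J → 0` of an ideal `J` of a polynomial ring
`R` with its standard grading. The module `F_i` is `⨁_{b ∈ ι i} R(-deg b)`. A linear map preserves
degrees if and only if it sends each basis element to an element of the same degree; the
coefficient at the basis element `a` then contains only monomials of degree `deg b - deg a`. -/
structure MinimalGradedFreeResolution {σ K : Type*} [Field K]
    (J : Ideal (MvPolynomial σ K)) where
  ι : ℕ → Type
  finite_ι : ∀ i, Finite (ι i)
  deg : ∀ i, ι i → ℤ
  d : ∀ i, (ι (i + 1) →₀ MvPolynomial σ K) →ₗ[MvPolynomial σ K] (ι i →₀ MvPolynomial σ K)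
  ε : (ι 0 →₀ MvPolynomial σ K) →ₗ[MvPolynomial σ K] J
  d_graded : ∀ i (b : ι (i + 1)) (a : ι i), ∀ s ∈ (d i (Finsupp.single b 1) a).support,
    (s.degree : ℤ) + deg i a = deg (i + 1) b
  ε_graded : ∀ b : ι 0, ∀ s ∈ (ε (Finsupp.single b 1) : MvPolynomial σ K).support,
    (s.degree : ℤ) = deg 0 b
  ε_surjective : Function.Surjective ε
  exact_zero : Function.Exact (d 0) ε
  exact_succ : ∀ i, Function.Exact (d (i + 1)) (d i)
  minimal : ∀ i, LinearMap.range (d i) ≤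
    Ideal.span (Set.range (X : σ → MvPolynomial σ K)) •
      (⊤ : Submodule (MvPolynomial σ K) (ι i →₀ MvPolynomial σ K))

namespace MinimalGradedFreeResolution

variable {σ K : Type*} [Field K] {J : Ideal (MvPolynomial σ K)}

/-- `β_{ij}`: the number of summands `R(-j)` of `F_i`. -/
def gradedBetti (F : MinimalGradedFreeResolution J) (i : ℕ) (j : ℤ) : ℕ :=
  Nat.card {b : F.ι i // F.deg i b = j}

/-- `β_i = ∑_j β_{ij}`; the sum has finitely many nonzero terms because `ι i` is finite. -/
def totalBetti (F : MinimalGradedFreeResolution J) (i : ℕ) : ℕ :=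
  ∑ᶠ j : ℤ, F.gradedBetti i j

theorem totalBetti_eq_card (F : MinimalGradedFreeResolution J) (i : ℕ) :
    F.totalBetti i = Nat.card (F.ι i) := by
  classical
  haveI := F.finite_ι i
  haveI := Fintype.ofFinite (F.ι i)
  unfold totalBetti gradedBetti
  rw [finsum_eq_sum_of_support_subset (s := Finset.univ.image (F.deg i))]
  · rw [Nat.card_eq_fintype_card, ← Finset.card_univ,
      Finset.card_eq_sum_card_image (F.deg i) Finset.univ]
    refine Finset.sum_congr rfl fun j _ => ?_
    rw [Nat.card_eq_fintype_card, Fintype.card_subtype]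
  · intro j hj
    rw [Function.mem_support] at hj
    obtain ⟨⟨b, hb⟩⟩ := (Nat.card_ne_zero.mp hj).1
    simp only [Finset.coe_image, Finset.coe_univ, Set.image_univ, Set.mem_range]
    exact ⟨b, hb⟩

end MinimalGradedFreeResolution

end StarLinearization

end

noncomputable section

namespace StarLinearization

/-! ### Linear resolutions -/

/-! The ideal `LIN(I)` has linear quotients. Since `M = 1`, its generators are all squarefree `x_a`
of degree `d`, together with the `x_u y_j` for which `u` has size `d - 1` and `x_u` divides `f_j`.
List the `x_a` in colexicographic order, then the `x_u y_j` grouped by `u` with `j` increasing. The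
colon ideal at `x_a` is generated by the variables `x_k`, `k ∉ a`, lying below some element of `a`.
At `x_u y_j` it is generated by the `n - d + 1` variables `x_k`, `k ∉ u`, and by the earlier
`y_{j'}` with `x_u` dividing `f_{j'}` (`hasLinRes_veronese`, `hasLinRes_edges`).

An ideal generated by `c` variables has a linear resolution of Koszul type, so by the mapping cone
(`LinRes.exists_cone`) each new generator keeps the resolution linear and adds `c.choose i` to its
`i`-th rank. A linear resolution is minimal, and the ranks of any two minimal resolutions agree
(`MinimalGradedFreeResolution.card_le_card`).

The rest is counting. The `x_a` contribute the first term (`sum_choose_card_gaps`). If `x_u` divides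
`D` generators, it contributes the sum of `(n - d + 1 + k).choose i` over `k < D`. For `j ≥ 2`, the
`u` with `D = j` correspond to the maximal `j`-clusters (`numMaxClusters_eq_card`), because two
distinct generators share at most one edge. Double counting gives `m d` for the sum of all `D`, so
the number of edges is `m d - ∑ (j - 1) C_j`; this is the coefficient of the `k = 0` terms. -/

/-- A linear free resolution `⋯ → F₁ → F₀ → J → 0` of an ideal generated in degree `q`:
all entries of the differentials are linear forms. -/
structure LinRes {σ K : Type*} [Field K] (J : Ideal (MvPolynomial σ K)) (q : ℕ) where
  ι : ℕ → Type
  finite_ι : ∀ i, Finite (ι i)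
  d : ∀ i, (ι (i + 1) →₀ MvPolynomial σ K) →ₗ[MvPolynomial σ K] (ι i →₀ MvPolynomial σ K)
  ε : (ι 0 →₀ MvPolynomial σ K) →ₗ[MvPolynomial σ K] MvPolynomial σ K
  d_hom : ∀ i b a, (d i (Finsupp.single b 1) a).IsHomogeneous 1
  ε_hom : ∀ b, (ε (Finsupp.single b 1)).IsHomogeneous q
  range_ε : LinearMap.range ε = J
  exact_zero : Function.Exact (d 0) ε
  exact_succ : ∀ i, Function.Exact (d (i + 1)) (d i)

/-! ### Homogeneous components and degree-preserving lifts -/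

section Homogeneous

variable {σ K : Type*} [Field K]

theorem homogeneousComponent_mul_of_isHomogeneous {e : ℕ} (k : ℕ) (p : MvPolynomial σ K)
    {t : MvPolynomial σ K} (ht : t.IsHomogeneous e) :
    homogeneousComponent (k + e) (p * t) = homogeneousComponent k p * t := by
  let _ : GradedAlgebra (homogeneousSubmodule σ K) := gradedAlgebra
  have h := DirectSum.coe_decompose_mul_of_right_mem_of_le
    (homogeneousSubmodule σ K) (a := p) (n := k + e) ht (Nat.le_add_left e k)
  rw [Nat.add_sub_cancel] at h
  exact (decomposition.decompose'_apply _ _).symm.trans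
    (h.trans (congrArg (· * t) (decomposition.decompose'_apply _ _)))

theorem homogeneousComponent_apply_of_isHomogeneous {α : Type*} {e : ℕ} (k : ℕ)
    (l : (α →₀ MvPolynomial σ K) →ₗ[MvPolynomial σ K] MvPolynomial σ K)
    (hl : ∀ b, (l (Finsupp.single b 1)).IsHomogeneous e) (x : α →₀ MvPolynomial σ K) :
    homogeneousComponent (k + e) (l x) =
      l (x.mapRange (homogeneousComponent k) (map_zero _)) := by
  induction x using Finsupp.induction_linear with
  | zero => simp
  | add f g hf hg =>
    rw [Finsupp.mapRange_add (map_add _), map_add, map_add, map_add, hf, hg]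
  | single a p =>
    have h : ∀ r : MvPolynomial σ K, l (Finsupp.single a r) = r * l (Finsupp.single a 1) := by
      intro r
      rw [← smul_eq_mul, ← map_smul, Finsupp.smul_single, smul_eq_mul, mul_one]
    rw [Finsupp.mapRange_single, h p, h (homogeneousComponent k p),
      homogeneousComponent_mul_of_isHomogeneous k p (hl a)]

theorem isHomogeneous_apply {α : Type*} {e k : ℕ}
    (l : (α →₀ MvPolynomial σ K) →ₗ[MvPolynomial σ K] MvPolynomial σ K)
    (hl : ∀ b, (l (Finsupp.single b 1)).IsHomogeneous e) (x : α →₀ MvPolynomial σ K)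
    (hx : ∀ b, (x b).IsHomogeneous k) : (l x).IsHomogeneous (k + e) := by
  have h : x.mapRange (homogeneousComponent k) (map_zero _) = x := by
    ext1 b
    rw [Finsupp.mapRange_apply, homogeneousComponent_of_mem (hx b), if_pos rfl]
  have := homogeneousComponent_apply_of_isHomogeneous k l hl x
  rw [h] at this
  rw [← this]
  exact homogeneousComponent_isHomogeneous _ _

/-- A homogeneous element in the image of a graded map has a homogeneous preimage. The functionals
`π` are the coordinates of the target. -/
theorem exists_isHomogeneous_preimage {α β N : Type*} [AddCommGroup N]
    [Module (MvPolynomial σ K) N] {e k : ℕ}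
    (T : (α →₀ MvPolynomial σ K) →ₗ[MvPolynomial σ K] N)
    (π : β → N →ₗ[MvPolynomial σ K] MvPolynomial σ K)
    (hπ : ∀ y y', (∀ a, π a y = π a y') → y = y')
    (hT : ∀ b a, (π a (T (Finsupp.single b 1))).IsHomogeneous e) (y : N)
    (hy : y ∈ LinearMap.range T) (hyk : ∀ a, (π a y).IsHomogeneous (k + e)) :
    ∃ x, T x = y ∧ ∀ b, (x b).IsHomogeneous k := by
  obtain ⟨x, rfl⟩ := hy
  -- Keep only the degree `k` part of an arbitrary preimage: `T` raises degrees by exactly `e`, so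
  -- this part already maps to `y`.
  refine ⟨x.mapRange (homogeneousComponent k) (map_zero _), hπ _ _ fun a => ?_, fun b => ?_⟩
  · have h := homogeneousComponent_apply_of_isHomogeneous k (π a ∘ₗ T) (fun b => hT b a) x
    rw [LinearMap.comp_apply, LinearMap.comp_apply] at h
    rw [← h, homogeneousComponent_of_mem (hyk a), if_pos rfl]
  · rw [Finsupp.mapRange_apply]
    exact homogeneousComponent_isHomogeneous _ _

/-- A map of free modules with linear entries lifts through a graded map, with linear entries. -/
theorem exists_linear_lift {α β γ N : Type*} [AddCommGroup N]
    [Module (MvPolynomial σ K) N] {e : ℕ}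
    (T : (α →₀ MvPolynomial σ K) →ₗ[MvPolynomial σ K] N)
    (π : β → N →ₗ[MvPolynomial σ K] MvPolynomial σ K)
    (hπ : ∀ y y', (∀ a, π a y = π a y') → y = y')
    (hT : ∀ b a, (π a (T (Finsupp.single b 1))).IsHomogeneous e)
    (S : (γ →₀ MvPolynomial σ K) →ₗ[MvPolynomial σ K] N)
    (hS : ∀ x, S x ∈ LinearMap.range T)
    (hSe : ∀ c a, (π a (S (Finsupp.single c 1))).IsHomogeneous (1 + e)) :
    ∃ θ : (γ →₀ MvPolynomial σ K) →ₗ[MvPolynomial σ K] (α →₀ MvPolynomial σ K),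
      T ∘ₗ θ = S ∧ ∀ c a, (θ (Finsupp.single c 1) a).IsHomogeneous 1 := by
  choose v hv hv1 using fun c => exists_isHomogeneous_preimage T π hπ hT
    (S (Finsupp.single c 1)) (hS _) (hSe c)
  refine ⟨Finsupp.linearCombination _ v, ?_, fun c a => ?_⟩
  · ext c
    simp [hv]
  · simpa using hv1 c a

end Homogeneous

/-- Recursive construction of a chain map whose components have the property `P`. -/
theorem exists_chainMap {R : Type*} [CommRing R] {F G : ℕ → Type*}
    [∀ i, AddCommGroup (F i)] [∀ i, Module R (F i)] [∀ i, AddCommGroup (G i)]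
    [∀ i, Module R (G i)] (dF : ∀ i, F (i + 1) →ₗ[R] F i) (dG : ∀ i, G (i + 1) →ₗ[R] G i)
    (P : ∀ i, (F i →ₗ[R] G i) → Prop) (φ₀ : F 0 →ₗ[R] G 0) (h₀ : P 0 φ₀)
    (step : ∀ i φ, P i φ → ∃ φ', dG i ∘ₗ φ' = φ ∘ₗ dF i ∧ P (i + 1) φ') :
    ∃ φ : ∀ i, F i →ₗ[R] G i, φ 0 = φ₀ ∧ (∀ i, dG i ∘ₗ φ (i + 1) = φ i ∘ₗ dF i) ∧
      ∀ i, P i (φ i) := by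
  choose next hnext hP using step
  let s : ∀ i, {φ : F i →ₗ[R] G i // P i φ} := fun i =>
    Nat.rec ⟨φ₀, h₀⟩ (fun i φ => ⟨next i φ.1 φ.2, hP i φ.1 φ.2⟩) i
  exact ⟨fun i => (s i).1, rfl, fun i => hnext i (s i).1 (s i).2, fun i => (s i).2⟩

/-! ### Block triangular maps of free modules -/

section Block

variable {R : Type*} [CommRing R] {α α' α'' β β' β'' : Type*}

/-- The upper triangular block map with diagonal `A`, `B` and off-diagonal entry `θ`. -/
def blockMap (A : (α →₀ R) →ₗ[R] (α' →₀ R)) (θ : (β →₀ R) →ₗ[R] (α' →₀ R))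
    (B : (β →₀ R) →ₗ[R] (β' →₀ R)) : (α ⊕ β →₀ R) →ₗ[R] (α' ⊕ β' →₀ R) :=
  (Finsupp.sumFinsuppLEquivProdFinsupp R).symm.toLinearMap ∘ₗ
    LinearMap.prod (A ∘ₗ LinearMap.fst R _ _ + θ ∘ₗ LinearMap.snd R _ _)
      (B ∘ₗ LinearMap.snd R _ _) ∘ₗ (Finsupp.sumFinsuppLEquivProdFinsupp R).toLinearMap

theorem blockMap_sumElim (A : (α →₀ R) →ₗ[R] (α' →₀ R)) (θ : (β →₀ R) →ₗ[R] (α' →₀ R))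
    (B : (β →₀ R) →ₗ[R] (β' →₀ R)) (x : α →₀ R) (y : β →₀ R) :
    blockMap A θ B (Finsupp.sumElim x y) = Finsupp.sumElim (A x + θ y) (B y) := by
  have h : Finsupp.sumFinsuppLEquivProdFinsupp R (Finsupp.sumElim x y) = (x, y) := by
    ext <;> simp
  simp only [blockMap, LinearMap.comp_apply, LinearEquiv.coe_coe, h]
  rfl

theorem exists_eq_sumElim (z : α ⊕ β →₀ R) : ∃ x y, z = Finsupp.sumElim x y :=
  ⟨(Finsupp.sumFinsuppLEquivProdFinsupp R z).1, (Finsupp.sumFinsuppLEquivProdFinsupp R z).2, by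
    ext (a | b) <;> simp⟩

theorem sumElim_eq_zero_iff {x : α →₀ R} {y : β →₀ R} :
    Finsupp.sumElim x y = 0 ↔ x = 0 ∧ y = 0 := by
  constructor
  · intro h
    exact ⟨Finsupp.ext fun a => by simpa using DFunLike.congr_fun h (Sum.inl a),
      Finsupp.ext fun a => by simpa using DFunLike.congr_fun h (Sum.inr a)⟩
  · rintro ⟨rfl, rfl⟩
    ext (a | b) <;> simp

theorem single_inl_eq_sumElim (a : α) (r : R) :
    (Finsupp.single (Sum.inl a) r : α ⊕ β →₀ R) = Finsupp.sumElim (Finsupp.single a r) 0 := by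
  classical
  ext (b | b) <;> simp [Finsupp.single_apply]

theorem single_inr_eq_sumElim (b : β) (r : R) :
    (Finsupp.single (Sum.inr b) r : α ⊕ β →₀ R) = Finsupp.sumElim 0 (Finsupp.single b r) := by
  classical
  ext (b | b) <;> simp [Finsupp.single_apply]

/-- The sign on the second diagonal block makes the contributions `A₀ θ₁` and `θ₀ B₁` cancel. Given
a cycle `(x, y)` with `y = B₁ w`, the element `x + θ₁ w` is a cycle for `A₀`, hence equals some `A₁
v`; then `(v, -w)` is the required preimage. -/
theorem blockMap_exact {A₁ : (α →₀ R) →ₗ[R] (α' →₀ R)} {A₀ : (α' →₀ R) →ₗ[R] (α'' →₀ R)}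
    {B₁ : (β →₀ R) →ₗ[R] (β' →₀ R)} {B₀ : (β' →₀ R) →ₗ[R] (β'' →₀ R)}
    {θ₁ : (β →₀ R) →ₗ[R] (α' →₀ R)} {θ₀ : (β' →₀ R) →ₗ[R] (α'' →₀ R)}
    (hA : Function.Exact A₁ A₀) (hB : Function.Exact B₁ B₀)
    (hθ : A₀ ∘ₗ θ₁ = θ₀ ∘ₗ B₁) :
    Function.Exact (blockMap A₁ θ₁ (-B₁)) (blockMap A₀ θ₀ (-B₀)) := by
  have hθ' : ∀ y, A₀ (θ₁ y) = θ₀ (B₁ y) := fun y => LinearMap.congr_fun hθ y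
  intro z
  obtain ⟨x, y, rfl⟩ := exists_eq_sumElim z
  rw [blockMap_sumElim, sumElim_eq_zero_iff]
  constructor
  · rintro ⟨h₁, h₂⟩
    rw [LinearMap.neg_apply, neg_eq_zero] at h₂
    obtain ⟨w, rfl⟩ := (hB y).1 h₂
    rw [← hθ', ← map_add] at h₁
    obtain ⟨v, hv⟩ := (hA _).1 h₁
    refine ⟨Finsupp.sumElim v (-w), ?_⟩
    rw [blockMap_sumElim, hv]
    simp
  · rintro ⟨w, hw⟩
    obtain ⟨v, w, rfl⟩ := exists_eq_sumElim w
    rw [blockMap_sumElim] at hw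
    have hx : x = A₁ v + θ₁ w := Finsupp.ext fun a => by
      simpa using (DFunLike.congr_fun hw (Sum.inl a)).symm
    have hy : y = -B₁ w := Finsupp.ext fun a => by
      simpa using (DFunLike.congr_fun hw (Sum.inr a)).symm
    subst hx hy
    simp [hA.apply_apply_eq_zero, hB.apply_apply_eq_zero, hθ']

end Block

/-! ### Mapping cones and ideals generated by variables -/

section Cone

variable {σ K : Type*} [Field K] {J : Ideal (MvPolynomial σ K)}

/-- Multiplication by `g` lifts to a map, with linear entries, from a resolution of `J : g` to one
of `J`. -/
theorem LinRes.exists_lift_mul {q : ℕ} (F : LinRes J q) {g : MvPolynomial σ K}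
    (hg : g.IsHomogeneous q) {L : Ideal (MvPolynomial σ K)} (hL : ∀ r, r ∈ L ↔ r * g ∈ J)
    (G : LinRes L 1) :
    ∃ θ : ∀ i, (G.ι i →₀ MvPolynomial σ K) →ₗ[MvPolynomial σ K] (F.ι i →₀ MvPolynomial σ K),
      (∀ x, F.ε (θ 0 x) = G.ε x * g) ∧ (∀ i, F.d i ∘ₗ θ (i + 1) = θ i ∘ₗ G.d i) ∧
      ∀ i c a, (θ i (Finsupp.single c 1) a).IsHomogeneous 1 := by
  obtain ⟨θ₀, h₀, h₀'⟩ := exists_linear_lift F.ε (β := Unit) (fun _ => LinearMap.id)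
    (fun y y' h => h ()) (fun b _ => F.ε_hom b) (LinearMap.mulRight _ g ∘ₗ G.ε)
    (fun x => by
      rw [F.range_ε]
      refine (hL _).1 ?_
      exact G.range_ε.le ⟨x, rfl⟩)
    (fun c _ => (G.ε_hom c).mul hg)
  obtain ⟨θ, hθ₀, hθ, hP⟩ := exists_chainMap G.d F.d
    -- Besides linearity of the entries, the invariant records that `φ ∘ d` lands in the image of
    -- the next differential, which is what the next lift needs.
    (fun i φ => (∀ c a, (φ (Finsupp.single c 1) a).IsHomogeneous 1) ∧
      ∀ x, φ (G.d i x) ∈ LinearMap.range (F.d i)) θ₀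
    ⟨h₀', fun x => by
      have : F.ε (θ₀ (G.d 0 x)) = 0 := by
        rw [← LinearMap.comp_apply, h₀, LinearMap.comp_apply,
          G.exact_zero.apply_apply_eq_zero, map_zero]
      exact (F.exact_zero _).1 this⟩
    (by
      rintro i φ ⟨h₁, h₂⟩
      obtain ⟨φ', h, h'⟩ := exists_linear_lift (F.d i) Finsupp.lapply
        (fun y y' h => Finsupp.ext h) (F.d_hom i) (φ ∘ₗ G.d i) h₂
        (fun c a => isHomogeneous_apply (Finsupp.lapply a ∘ₗ φ) (fun b => h₁ b a) _
          (G.d_hom i c))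
      refine ⟨φ', h, h', fun x => (F.exact_succ i _).1 ?_⟩
      rw [← LinearMap.comp_apply, h, LinearMap.comp_apply,
        (G.exact_succ i).apply_apply_eq_zero, map_zero])
  refine ⟨θ, fun x => ?_, hθ, fun i => (hP i).1⟩
  rw [hθ₀, ← LinearMap.comp_apply, h₀]
  rfl

/-- The index types of the mapping cone. -/
def coneIndex (ι κ : ℕ → Type) : ℕ → Type
  -- `Unit` indexes the new generator `g`. Since `κ` resolves the ideal `J : g` and not its quotient
  -- ring, `κ i` enters in step `i + 1`.
  | 0 => ι 0 ⊕ Unit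
  | i + 1 => ι (i + 1) ⊕ κ i

/-- The differential of the mapping cone. -/
def coneD {R : Type*} [CommRing R] {ι κ : ℕ → Type} (dF : ∀ i, (ι (i + 1) →₀ R) →ₗ[R] (ι i →₀ R))
    (dG : ∀ i, (κ (i + 1) →₀ R) →ₗ[R] (κ i →₀ R)) (εG : (κ 0 →₀ R) →ₗ[R] R)
    (θ : ∀ i, (κ i →₀ R) →ₗ[R] (ι i →₀ R)) :
    ∀ i, (coneIndex ι κ (i + 1) →₀ R) →ₗ[R] (coneIndex ι κ i →₀ R)
  | 0 => blockMap (dF 0) (θ 0) (-(Finsupp.lsingle () ∘ₗ εG))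
  | i + 1 => blockMap (dF (i + 1)) (θ (i + 1)) (-(dG i))

theorem isHomogeneous_blockMap {α α' β β' : Type*} {k : ℕ}
    {A : (α →₀ MvPolynomial σ K) →ₗ[MvPolynomial σ K] (α' →₀ MvPolynomial σ K)}
    {θ : (β →₀ MvPolynomial σ K) →ₗ[MvPolynomial σ K] (α' →₀ MvPolynomial σ K)}
    {B : (β →₀ MvPolynomial σ K) →ₗ[MvPolynomial σ K] (β' →₀ MvPolynomial σ K)}
    (hA : ∀ b a, (A (Finsupp.single b 1) a).IsHomogeneous k)
    (hθ : ∀ b a, (θ (Finsupp.single b 1) a).IsHomogeneous k)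
    (hB : ∀ b a, (B (Finsupp.single b 1) a).IsHomogeneous k) (b : α ⊕ β) (a : α' ⊕ β') :
    (blockMap A θ B (Finsupp.single b 1) a).IsHomogeneous k := by
  rcases b with b | b
  · rw [single_inl_eq_sumElim, blockMap_sumElim, map_zero, map_zero, add_zero]
    rcases a with a | a
    · simpa using hA b a
    · simpa using isHomogeneous_zero σ K k
  · rw [single_inr_eq_sumElim, blockMap_sumElim, map_zero, zero_add]
    rcases a with a | a
    · simpa using hθ b a
    · simpa using hB b a

/-- The mapping cone: a linear resolution of `J + (g)` from those of `J` and `J : g`. -/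
theorem LinRes.exists_cone {q : ℕ} (F : LinRes J q) {g : MvPolynomial σ K}
    (hg : g.IsHomogeneous q) {L : Ideal (MvPolynomial σ K)} (hL : ∀ r, r ∈ L ↔ r * g ∈ J)
    (G : LinRes L 1) :
    ∃ H : LinRes (J ⊔ Ideal.span {g}) q, H.ι = coneIndex F.ι G.ι := by
  obtain ⟨θ, hθ₀, hθ, hθl⟩ := F.exists_lift_mul hg hL G
  have hF := F.finite_ι
  have hG := G.finite_ι
  let ε : (F.ι 0 ⊕ Unit →₀ MvPolynomial σ K) →ₗ[MvPolynomial σ K] MvPolynomial σ K :=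
    LinearMap.coprod F.ε (LinearMap.mulRight _ g ∘ₗ Finsupp.lapply ()) ∘ₗ
      (Finsupp.sumFinsuppLEquivProdFinsupp (MvPolynomial σ K)).toLinearMap
  have hε : ∀ x y, ε (Finsupp.sumElim x y) = F.ε x + y () * g := by
    intro x y
    have h : Finsupp.sumFinsuppLEquivProdFinsupp (MvPolynomial σ K)
        (Finsupp.sumElim x y) = (x, y) := by
      ext1 <;> ext1 <;> simp
    simp only [ε, LinearMap.comp_apply, LinearEquiv.coe_coe, h]
    rfl
  have hhom : ∀ b, (ε (Finsupp.single b 1)).IsHomogeneous q := by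
    rintro (b | b)
    · rw [single_inl_eq_sumElim, hε]
      simpa using F.ε_hom b
    · rw [single_inr_eq_sumElim, hε]
      simpa using hg
  have hrange : LinearMap.range ε = J ⊔ Ideal.span {g} := by
    apply le_antisymm
    · rintro _ ⟨z, rfl⟩
      obtain ⟨x, y, rfl⟩ := exists_eq_sumElim z
      rw [hε]
      exact Submodule.add_mem_sup (F.range_ε.le ⟨x, rfl⟩)
        (Ideal.mul_mem_left _ _ (Ideal.mem_span_singleton_self g))
    · refine sup_le ?_ ?_
      · intro r hr
        obtain ⟨x, rfl⟩ := F.range_ε.ge hr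
        exact ⟨Finsupp.sumElim x 0, by simp [hε]⟩
      · rw [Ideal.span_singleton_le_iff_mem]
        exact ⟨Finsupp.sumElim 0 (Finsupp.single () 1), by rw [hε]; simp⟩
  have hexact : Function.Exact
      (blockMap (F.d 0) (θ 0) (-(Finsupp.lsingle () ∘ₗ G.ε))) ε := by
    intro z
    obtain ⟨x, y, rfl⟩ := exists_eq_sumElim z
    rw [hε]
    constructor
    · intro h
      -- A relation `ε x + y g = 0` puts the coefficient `y` of `g` into the colon ideal.
      have hy : y () ∈ L := (hL _).2 (F.range_ε.le
        ⟨-x, by rw [map_neg]; linear_combination -h⟩)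
      obtain ⟨w, hw⟩ := G.range_ε.ge hy
      rw [← hw, ← hθ₀, ← map_add] at h
      obtain ⟨v, hv⟩ := (F.exact_zero _).1 h
      refine ⟨Finsupp.sumElim v (-w), ?_⟩
      have hy' : y = Finsupp.single () (G.ε w) := by
        ext1
        simp [hw]
      rw [blockMap_sumElim, hv, hy']
      simp
    · rintro ⟨z, hz⟩
      obtain ⟨v, w, rfl⟩ := exists_eq_sumElim z
      rw [blockMap_sumElim] at hz
      have hx : x = F.d 0 v + θ 0 w := Finsupp.ext fun a => by
        simpa using (DFunLike.congr_fun hz (Sum.inl a)).symm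
      have hy : y () = - G.ε w := by
        simpa using (DFunLike.congr_fun hz (Sum.inr ())).symm
      rw [hx, hy, map_add, F.exact_zero.apply_apply_eq_zero, hθ₀]
      ring
  refine ⟨⟨coneIndex F.ι G.ι, ?_, coneD F.d G.d G.ε θ, ε, ?_, hhom, hrange, hexact, ?_⟩, rfl⟩
  · rintro (_ | i)
    · exact inferInstanceAs (Finite (F.ι 0 ⊕ Unit))
    · exact inferInstanceAs (Finite (F.ι (i + 1) ⊕ G.ι i))
  · rintro (_ | i)
    · refine isHomogeneous_blockMap (F.d_hom 0) (hθl 0) fun b a => ?_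
      have h : (-(Finsupp.lsingle () ∘ₗ G.ε)) (Finsupp.single b 1) a =
          -G.ε (Finsupp.single b 1) := by
        simp
      rw [h]
      exact (G.ε_hom b).neg
    · refine isHomogeneous_blockMap (F.d_hom (i + 1)) (hθl (i + 1)) fun b a => ?_
      exact (G.d_hom i b a).neg
  · rintro (_ | i)
    · refine blockMap_exact (F.exact_succ 0) ?_ (hθ 0)
      intro x
      rw [← G.exact_zero x]
      simp
    · exact blockMap_exact (F.exact_succ (i + 1)) (G.exact_succ i) (hθ (i + 1))

/-- `J` has a linear resolution, with generators in degree `q` and with ranks `b`. -/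
def HasLinRes (J : Ideal (MvPolynomial σ K)) (q : ℕ) (b : ℕ → ℕ) : Prop :=
  ∃ F : LinRes J q, ∀ i, Nat.card (F.ι i) = b i

theorem hasLinRes_bot (q : ℕ) : HasLinRes (⊥ : Ideal (MvPolynomial σ K)) q 0 := by
  refine ⟨⟨fun _ => Empty, fun _ => inferInstance, fun _ => 0, 0, fun _ b => b.elim,
    fun b => b.elim, LinearMap.range_zero, ?_, fun i => ?_⟩, fun i => by simp⟩
  · exact fun x => ⟨fun _ => ⟨0, Subsingleton.elim _ _⟩, fun _ => rfl⟩
  · exact fun x => ⟨fun _ => ⟨0, Subsingleton.elim _ _⟩, fun _ => rfl⟩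

theorem HasLinRes.cone {q : ℕ} {b c b' : ℕ → ℕ} (hJ : HasLinRes J q b) {g : MvPolynomial σ K}
    (hg : g.IsHomogeneous q) {L : Ideal (MvPolynomial σ K)} (hL : ∀ r, r ∈ L ↔ r * g ∈ J)
    (hLc : HasLinRes L 1 c) (h₀ : b' 0 = b 0 + 1) (hs : ∀ i, b' (i + 1) = b (i + 1) + c i) :
    HasLinRes (J ⊔ Ideal.span {g}) q b' := by
  obtain ⟨F, hF⟩ := hJ
  obtain ⟨G, hG⟩ := hLc
  have := F.finite_ι
  have := G.finite_ι
  obtain ⟨H, hH⟩ := F.exists_cone hg hL G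
  refine ⟨H, ?_⟩
  rw [hH]
  rintro (_ | i)
  · rw [h₀, ← hF]
    change Nat.card (F.ι 0 ⊕ Unit) = _
    simp [Nat.card_sum]
  · rw [hs, ← hF, ← hG]
    change Nat.card (F.ι (i + 1) ⊕ G.ι i) = _
    exact Nat.card_sum

/-- An ideal generated by variables has a linear resolution. -/
theorem hasLinRes_span_X (S : Finset σ) :
    HasLinRes (Ideal.span ((X : σ → MvPolynomial σ K) '' S)) 1
      (fun i => S.card.choose (i + 1)) := by
  classical
  induction S using Finset.induction_on with
  | empty =>
    have h := hasLinRes_bot (σ := σ) (K := K) 1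
    simpa [Pi.zero_def] using h
  | insert k S hk ih =>
    rw [Finset.coe_insert, Set.image_insert_eq, Ideal.span_insert, sup_comm]
    -- A variable outside `S` is a nonzerodivisor modulo the variables in `S`, so the colon ideal is
    -- the ideal itself and `ih` serves twice. The ranks then follow Pascal's rule.
    refine ih.cone (isHomogeneous_X K k) (fun r => ?_) ih ?_ fun i => ?_
    · refine ⟨Ideal.mul_mem_right _ _, fun h => ?_⟩
      rw [mem_ideal_span_X_image] at h ⊢
      intro s hs
      obtain ⟨l, hl, hsl⟩ := h (s + Finsupp.single k 1) (by
        rw [mem_support_iff, coeff_mul_X]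
        exact mem_support_iff.1 hs)
      refine ⟨l, hl, ?_⟩
      have hne : k ≠ l := fun h => hk (h ▸ hl)
      simpa [Finsupp.single_apply, hne] using hsl
    · simp [Finset.card_insert_of_notMem hk]
    · rw [Finset.card_insert_of_notMem hk, Nat.choose_succ_succ, add_comm]

/-- Adding a generator whose colon ideal is generated by variables. -/
theorem HasLinRes.sup_span {q : ℕ} {b : ℕ → ℕ} (hJ : HasLinRes J q b) {g : MvPolynomial σ K}
    (hg : g.IsHomogeneous q) (S : Finset σ)
    (hS : ∀ r, r ∈ Ideal.span ((X : σ → MvPolynomial σ K) '' S) ↔ r * g ∈ J) :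
    HasLinRes (J ⊔ Ideal.span {g}) q (fun i => b i + S.card.choose i) :=
  -- The colon ideal has ranks `choose (i + 1)`; shifted by one in the cone, with the new generator
  -- as `choose 0`, they become `choose i`.
  hJ.cone hg hS (hasLinRes_span_X S) (by simp) fun _ => rfl

end Cone

/-! ### Monomial ideals with linear quotients -/

section LinearQuotients

variable {σ K : Type*} [Field K]

/-- The colon of a monomial ideal by a monomial, when it is generated by variables. -/
theorem mem_span_X_iff_mul_monomial_mem {A : Set (σ →₀ ℕ)} {s : σ →₀ ℕ} {S : Set σ}
    (h₁ : ∀ a ∈ A, ∃ k ∈ S, s k < a k) (h₂ : ∀ k ∈ S, ∃ a ∈ A, a ≤ s + Finsupp.single k 1)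
    (r : MvPolynomial σ K) :
    r ∈ Ideal.span ((X : σ → MvPolynomial σ K) '' S) ↔
      r * monomial s 1 ∈ Ideal.span ((fun a => monomial a (1 : K)) '' A) := by
  constructor
  · intro hr
    have hle : Ideal.span ((X : σ → MvPolynomial σ K) '' S) ≤
        Submodule.comap
          (LinearMap.mulRight (MvPolynomial σ K) (monomial s (1 : K)))
          (Ideal.span ((fun a => monomial a (1 : K)) '' A)) := by
      rw [Ideal.span_le]
      rintro _ ⟨k, hk, rfl⟩
      obtain ⟨a, ha, has⟩ := h₂ k hk
      change X k * monomial s (1 : K) ∈ Ideal.span _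
      have : X k * monomial s (1 : K) =
          monomial (s + Finsupp.single k 1 - a) 1 * monomial a 1 := by
        rw [X, monomial_mul, monomial_mul, tsub_add_cancel_of_le has, add_comm]
      rw [this]
      exact Ideal.mul_mem_left _ _ (Ideal.subset_span ⟨a, ha, rfl⟩)
    exact hle hr
  · intro h
    rw [mem_ideal_span_monomial_image] at h
    rw [mem_ideal_span_X_image]
    intro t ht
    obtain ⟨a, ha, hat⟩ := h (t + s) (by
      rw [mem_support_iff, coeff_mul_monomial, mul_one]
      exact mem_support_iff.1 ht)
    obtain ⟨k, hk, hlt⟩ := h₁ a ha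
    -- If `x_k` did not divide `t`, then `a ≤ t + s` would give `a k ≤ s k`, against the choice of
    -- `k`.
    refine ⟨k, hk, fun h0 => ?_⟩
    have := hat k
    rw [Finsupp.add_apply, h0, zero_add] at this
    omega

/-- Monomial ideals with linear quotients: the generators `e a`, `a ∈ T`, are added to those in
`A` in increasing order, and the colon ideal at `a` is generated by the variables in `S a`. -/
theorem HasLinRes.linearQuotients {α : Type*} [LinearOrder α] {q : ℕ} {b : ℕ → ℕ}
    {A : Set (σ →₀ ℕ)}
    (hA : HasLinRes (Ideal.span ((fun a => monomial a (1 : K)) '' A)) q b)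
    (T : Finset α) (e : α → σ →₀ ℕ) (S : α → Finset σ) (he : ∀ a ∈ T, (e a).degree = q)
    (h₁ : ∀ a ∈ T, ∀ s ∈ A, ∃ k ∈ S a, e a k < s k)
    (h₂ : ∀ a ∈ T, ∀ a' ∈ T, a' < a → ∃ k ∈ S a, e a k < e a' k)
    (h₃ : ∀ a ∈ T, ∀ k ∈ S a, (∃ s ∈ A, s ≤ e a + Finsupp.single k 1) ∨
      ∃ a' ∈ T, a' < a ∧ e a' ≤ e a + Finsupp.single k 1) :
    HasLinRes (Ideal.span ((fun a => monomial a (1 : K)) '' (A ∪ e '' T))) q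
      (fun i => b i + ∑ a ∈ T, (S a).card.choose i) := by
  classical
  induction T using Finset.induction_on_max with
  | empty => simpa using hA
  | insert a T hmax ih =>
    have haT : a ∉ T := fun h => lt_irrefl _ (hmax a h)
    have ih' := ih (fun c hc => he c (Finset.mem_insert_of_mem hc))
      (fun c hc => h₁ c (Finset.mem_insert_of_mem hc))
      (fun c hc c' hc' => h₂ c (Finset.mem_insert_of_mem hc) c' (Finset.mem_insert_of_mem hc'))
      (fun c hc k hk => by
        refine (h₃ c (Finset.mem_insert_of_mem hc) k hk).imp id ?_
        rintro ⟨c', hc', hlt, hle⟩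
        -- A witness below `c` cannot be the new maximum `a`.
        refine ⟨c', (Finset.mem_insert.1 hc').resolve_left ?_, hlt, hle⟩
        rintro rfl
        exact lt_asymm hlt (hmax c hc))
    have key := ih'.sup_span (g := monomial (e a) 1)
      (isHomogeneous_monomial 1 (he a (Finset.mem_insert_self a T))) (S a)
      (mem_span_X_iff_mul_monomial_mem (by
        rintro s (hs | ⟨c, hc, rfl⟩)
        · exact h₁ a (Finset.mem_insert_self a T) s hs
        · exact h₂ a (Finset.mem_insert_self a T) c (Finset.mem_insert_of_mem hc) (hmax c hc))
        (by
          intro k hk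
          rcases h₃ a (Finset.mem_insert_self a T) k hk with ⟨s, hs, hle⟩ | ⟨c, hc, hlt, hle⟩
          · exact ⟨s, Or.inl hs, hle⟩
          · exact ⟨e c, Or.inr ⟨c, (Finset.mem_insert.1 hc).resolve_left hlt.ne, rfl⟩, hle⟩))
    rw [Finset.coe_insert, Set.image_insert_eq, Set.union_insert, Set.image_insert_eq,
      Ideal.span_insert, sup_comm]
    convert key using 2 with i
    rw [Finset.sum_insert haT, add_assoc, add_comm (Nat.choose _ _)]

end LinearQuotients

/-! ### Uniqueness of the ranks of a minimal resolution -/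

section Uniqueness

variable {σ K : Type*} [Field K] {J : Ideal (MvPolynomial σ K)}

theorem mem_span_X_iff_constantCoeff (p : MvPolynomial σ K) :
    p ∈ Ideal.span (Set.range (X : σ → MvPolynomial σ K)) ↔ constantCoeff p = 0 := by
  rw [← Set.image_univ, mem_ideal_span_X_image, constantCoeff_eq]
  constructor
  · intro h
    by_contra h0
    obtain ⟨k, -, hk⟩ := h 0 (mem_support_iff.2 h0)
    exact hk rfl
  · intro h s hs
    have hs0 : s ≠ 0 := by
      rintro rfl
      exact mem_support_iff.1 hs h
    obtain ⟨k, hk⟩ := Finsupp.ne_iff.1 hs0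
    exact ⟨k, Set.mem_univ _, hk⟩

theorem mem_ideal_smul_top_finsupp_iff {R ι : Type*} [CommRing R] (𝔪 : Ideal R) (x : ι →₀ R) :
    x ∈ 𝔪 • (⊤ : Submodule R (ι →₀ R)) ↔ ∀ a, x a ∈ 𝔪 := by
  constructor
  · intro h a
    have h' := Submodule.mem_map_of_mem (f := Finsupp.lapply (R := R) a) h
    rw [Submodule.map_smul''] at h'
    have := Submodule.smul_mono (le_refl 𝔪) (le_top (a := Submodule.map (Finsupp.lapply a) ⊤)) h'
    simpa using this
  · intro h
    rw [← Finsupp.sum_single x]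
    refine Submodule.sum_mem _ fun a _ => ?_
    have : (Finsupp.single a (x a) : ι →₀ R) = x a • Finsupp.single a 1 := by simp
    rw [this]
    exact Submodule.smul_mem_smul (h a) trivial

/-- The submodule `𝔪 F` of a free module `F`, for the irrelevant ideal `𝔪`. -/
abbrev irrelevantSMul (σ K : Type*) [Field K] (M : Type*) [AddCommGroup M]
    [Module (MvPolynomial σ K) M] : Submodule (MvPolynomial σ K) M :=
  Ideal.span (Set.range (X : σ → MvPolynomial σ K)) • ⊤

theorem mem_irrelevantSMul_iff {ι : Type*} (x : ι →₀ MvPolynomial σ K) :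
    x ∈ irrelevantSMul σ K (ι →₀ MvPolynomial σ K) ↔ ∀ a, constantCoeff (x a) = 0 := by
  simp only [irrelevantSMul, mem_ideal_smul_top_finsupp_iff, mem_span_X_iff_constantCoeff]

theorem map_mem_irrelevantSMul {M N : Type*} [AddCommGroup M] [AddCommGroup N]
    [Module (MvPolynomial σ K) M] [Module (MvPolynomial σ K) N]
    (φ : M →ₗ[MvPolynomial σ K] N) {x : M} (hx : x ∈ irrelevantSMul σ K M) :
    φ x ∈ irrelevantSMul σ K N := by
  have h := Submodule.mem_map_of_mem (f := φ) hx
  rw [irrelevantSMul, Submodule.map_smul''] at h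
  exact Submodule.smul_mono le_rfl le_top h

theorem exists_lift_of_range_le {R α M N : Type*} [CommRing R] [AddCommGroup M] [Module R M]
    [AddCommGroup N] [Module R N] (T : M →ₗ[R] N) (S : (α →₀ R) →ₗ[R] N)
    (h : ∀ x, S x ∈ LinearMap.range T) : ∃ θ : (α →₀ R) →ₗ[R] M, T ∘ₗ θ = S := by
  choose v hv using fun a => h (Finsupp.single a 1)
  refine ⟨Finsupp.linearCombination _ v, ?_⟩
  ext a
  simp [hv]

namespace MinimalGradedFreeResolution

/-- The identity of `J` lifts step by step because the source is free and the target exact. Degrees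
need not be tracked: ranks are compared through constant terms alone. -/
theorem exists_comparison (F G : MinimalGradedFreeResolution J) :
    ∃ φ : ∀ i, (F.ι i →₀ MvPolynomial σ K) →ₗ[MvPolynomial σ K] (G.ι i →₀ MvPolynomial σ K),
      G.ε ∘ₗ φ 0 = F.ε ∧ ∀ i, G.d i ∘ₗ φ (i + 1) = φ i ∘ₗ F.d i := by
  obtain ⟨φ₀, h₀⟩ := exists_lift_of_range_le G.ε F.ε fun x => G.ε_surjective _
  obtain ⟨φ, hφ₀, hφ, -⟩ := exists_chainMap F.d G.d
    (fun i φ => ∀ x, φ (F.d i x) ∈ LinearMap.range (G.d i)) φ₀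
    (fun x => (G.exact_zero _).1 (by
      rw [← LinearMap.comp_apply, h₀, F.exact_zero.apply_apply_eq_zero]))
    (fun i φ h => by
      obtain ⟨φ', h'⟩ := exists_lift_of_range_le (G.d i) (φ ∘ₗ F.d i) h
      refine ⟨φ', h', fun x => (G.exact_succ i _).1 ?_⟩
      rw [← LinearMap.comp_apply, h', LinearMap.comp_apply,
        (F.exact_succ i).apply_apply_eq_zero, map_zero])
  exact ⟨φ, hφ₀ ▸ h₀, hφ⟩

/-- A chain endomorphism of a minimal resolution that lifts zero is zero modulo the
irrelevant ideal. -/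
theorem mem_irrelevantSMul_of_lifts_zero (F : MinimalGradedFreeResolution J)
    (δ : ∀ i, (F.ι i →₀ MvPolynomial σ K) →ₗ[MvPolynomial σ K] (F.ι i →₀ MvPolynomial σ K))
    (h₀ : F.ε ∘ₗ δ 0 = 0) (hδ : ∀ i, F.d i ∘ₗ δ (i + 1) = δ i ∘ₗ F.d i) (i : ℕ)
    (x : F.ι i →₀ MvPolynomial σ K) : δ i x ∈ irrelevantSMul σ K _ := by
  have hd : ∀ i y, F.d i y ∈ irrelevantSMul σ K (F.ι i →₀ MvPolynomial σ K) :=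
    fun i y => F.minimal i ⟨y, rfl⟩
  -- Null-homotopy: `δ i = d_i h_i + h_{i-1} d_{i-1}`, where `k` stands for the second term and is
  -- zero at `i = 0`. Recording `k ∘ d_i = 0` keeps the induction free of the index `i - 1`. Both
  -- terms are zero modulo the irrelevant ideal by minimality.
  have key : ∃ (h : (F.ι i →₀ MvPolynomial σ K) →ₗ[MvPolynomial σ K]
      (F.ι (i + 1) →₀ MvPolynomial σ K)) (k : (F.ι i →₀ MvPolynomial σ K) →ₗ[MvPolynomial σ K]
      (F.ι i →₀ MvPolynomial σ K)), δ i = F.d i ∘ₗ h + k ∧ k ∘ₗ F.d i = 0 ∧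
      ∀ x, k x ∈ irrelevantSMul σ K _ := by
    clear x
    induction i with
    | zero =>
      obtain ⟨h, hh⟩ := exists_lift_of_range_le (F.d 0) (δ 0) fun x =>
        (F.exact_zero _).1 (LinearMap.congr_fun h₀ x)
      exact ⟨h, 0, by simp [hh], by simp, fun x => by simp⟩
    | succ i ih =>
      obtain ⟨h, k, e, hk, hkm⟩ := ih
      obtain ⟨h', hh'⟩ := exists_lift_of_range_le (F.d (i + 1)) (δ (i + 1) - h ∘ₗ F.d i)
        fun x => (F.exact_succ i _).1 (by
          have e₁ := LinearMap.congr_fun (hδ i) x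
          have e₂ := LinearMap.congr_fun hk x
          simp only [LinearMap.comp_apply, e, LinearMap.add_apply, LinearMap.zero_apply]
            at e₁ e₂
          simp [e₁, e₂])
      refine ⟨h', h ∘ₗ F.d i, LinearMap.ext fun x => ?_, ?_,
        fun x => map_mem_irrelevantSMul h (hd i x)⟩
      · rw [hh', LinearMap.add_apply, LinearMap.sub_apply, sub_add_cancel]
      · refine LinearMap.ext fun x => ?_
        simp [(F.exact_succ i).apply_apply_eq_zero]
  obtain ⟨h, k, e, -, hk⟩ := key
  rw [e]
  exact Submodule.add_mem _ (hd i _) (hk x)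

/-- With `φ` and `ψ` lifting the identity in both directions, `ψ φ - id` lifts zero, so `ψ φ` is the
identity modulo the irrelevant ideal. Hence `φ` becomes injective on the vector spaces over `K`
obtained by taking constant terms, and dimensions compare. -/
theorem card_le_card (F G : MinimalGradedFreeResolution J) (i : ℕ) :
    Nat.card (F.ι i) ≤ Nat.card (G.ι i) := by
  have := F.finite_ι i
  have := G.finite_ι i
  have := Fintype.ofFinite (F.ι i)
  have := Fintype.ofFinite (G.ι i)
  obtain ⟨φ, hφ₀, hφ⟩ := F.exists_comparison G
  obtain ⟨ψ, hψ₀, hψ⟩ := G.exists_comparison F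
  have hm := F.mem_irrelevantSMul_of_lifts_zero (fun i => ψ i ∘ₗ φ i - LinearMap.id)
    (by
      rw [LinearMap.comp_sub, ← LinearMap.comp_assoc, hψ₀, hφ₀, LinearMap.comp_id]
      refine LinearMap.ext fun x => ?_
      rw [LinearMap.sub_apply, sub_self, LinearMap.zero_apply])
    (fun i => by
      rw [LinearMap.comp_sub, LinearMap.sub_comp, ← LinearMap.comp_assoc, hψ,
        LinearMap.comp_assoc, hφ]
      rfl) i
  let inc : (F.ι i →₀ K) →ₗ[K] (F.ι i →₀ MvPolynomial σ K) :=
    Finsupp.mapRange.linearMap (Algebra.linearMap K (MvPolynomial σ K))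
  let res : (G.ι i →₀ MvPolynomial σ K) →ₗ[K] (G.ι i →₀ K) :=
    Finsupp.mapRange.linearMap (lcoeff K 0)
  have hinj : Function.Injective (res ∘ₗ (φ i).restrictScalars K ∘ₗ inc) := by
    rw [← LinearMap.ker_eq_bot, LinearMap.ker_eq_bot']
    intro x hx
    -- If `φ` kills the constant vector `x` modulo the irrelevant ideal, then so does `ψ φ`, which
    -- is congruent to the identity; so `x` has zero constant terms.
    have h₁ : φ i (inc x) ∈ irrelevantSMul σ K _ := by
      rw [mem_irrelevantSMul_iff]
      intro a
      exact DFunLike.congr_fun hx a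
    have h₂ := Submodule.sub_mem _ (map_mem_irrelevantSMul (ψ i) h₁) (hm (inc x))
    simp only [LinearMap.sub_apply, LinearMap.comp_apply, LinearMap.id_apply,
      sub_sub_cancel] at h₂
    rw [mem_irrelevantSMul_iff] at h₂
    ext a
    simpa [inc, algebraMap_eq] using h₂ a
  have := LinearMap.finrank_le_finrank_of_injective hinj
  simpa [Nat.card_eq_fintype_card] using this

theorem totalBetti_eq (F G : MinimalGradedFreeResolution J) (i : ℕ) :
    F.totalBetti i = G.totalBetti i := by
  rw [totalBetti_eq_card, totalBetti_eq_card]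
  exact le_antisymm (F.card_le_card G i) (G.card_le_card F i)

end MinimalGradedFreeResolution

/-- A linear resolution is a minimal graded free resolution. -/
def LinRes.toMinimal {q : ℕ} (F : LinRes J q) : MinimalGradedFreeResolution J where
  ι := F.ι
  finite_ι := F.finite_ι
  deg i _ := q + i
  d := F.d
  ε := F.ε.codRestrict J fun x => F.range_ε.le ⟨x, rfl⟩
  d_graded i b a s hs := by
    have h : s.degree = 1 := by
      rw [Finsupp.degree_eq_weight_one]
      exact F.d_hom i b a (mem_support_iff.1 hs)
    rw [h]
    push_cast
    ring
  ε_graded b s hs := by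
    have h : s.degree = q := by
      rw [Finsupp.degree_eq_weight_one]
      exact F.ε_hom b (mem_support_iff.1 hs)
    rw [h]
    simp
  ε_surjective := by
    rintro ⟨y, hy⟩
    obtain ⟨x, rfl⟩ := F.range_ε.ge hy
    exact ⟨x, rfl⟩
  exact_zero x := by
    rw [← F.exact_zero x, ← Subtype.coe_inj]
    rfl
  exact_succ := F.exact_succ
  minimal i := by
    rintro _ ⟨y, rfl⟩
    induction y using Finsupp.induction_linear with
    | zero => simp
    | add y z hy hz =>
      rw [map_add]
      exact Submodule.add_mem _ hy hz
    | single b p =>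
      have h : (Finsupp.single b p : F.ι (i + 1) →₀ MvPolynomial σ K) =
          p • Finsupp.single b 1 := by simp
      rw [h, map_smul]
      refine Submodule.smul_mem _ _ ((mem_irrelevantSMul_iff _).2 fun a => ?_)
      rw [constantCoeff_eq]
      exact (F.d_hom i b a).coeff_eq_zero (by simp)

theorem HasLinRes.nonempty_and_totalBetti {q : ℕ} {b : ℕ → ℕ} (h : HasLinRes J q b) :
    Nonempty (MinimalGradedFreeResolution J) ∧
      ∀ (F : MinimalGradedFreeResolution J) (i : ℕ), F.totalBetti i = b i := by
  obtain ⟨G, hG⟩ := h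
  refine ⟨⟨G.toMinimal⟩, fun F i => ?_⟩
  rw [F.totalBetti_eq G.toMinimal, MinimalGradedFreeResolution.totalBetti_eq_card, ← hG]
  rfl

end Uniqueness

/-! ### Squarefree monomials as finite sets -/

section Squarefree

variable {τ : Type*}

/-- The exponent vector of the squarefree monomial with support `s`. -/
def sqf (s : Finset τ) : τ →₀ ℕ := Finsupp.indicator s fun _ _ => 1

theorem sqf_apply [DecidableEq τ] (s : Finset τ) (k : τ) : sqf s k = if k ∈ s then 1 else 0 := by
  simp [sqf, Finsupp.indicator_apply]

theorem support_sqf (s : Finset τ) : (sqf s).support = s := by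
  classical
  ext k
  simp [sqf_apply]

theorem degree_sqf (s : Finset τ) : (sqf s).degree = s.card := by
  classical
  rw [Finsupp.degree_apply, support_sqf, Finset.card_eq_sum_ones]
  exact Finset.sum_congr rfl fun k hk => by rw [sqf_apply, if_pos hk]

theorem IsSquarefreeMonomial.eq_sqf {s : τ →₀ ℕ} (hs : IsSquarefreeMonomial s) :
    s = sqf s.support := by
  classical
  ext k
  rw [sqf_apply]
  have := hs k
  split_ifs with h
  · have := Finsupp.mem_support_iff.1 h
    omega
  · exact Finsupp.notMem_support_iff.1 h

theorem isSquarefreeMonomial_sqf (s : Finset τ) : IsSquarefreeMonomial (sqf s) := by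
  classical
  intro k
  rw [sqf_apply]
  split_ifs <;> simp

theorem IsSquarefreeMonomial.card_support {s : τ →₀ ℕ} (hs : IsSquarefreeMonomial s) :
    s.support.card = s.degree := by
  conv_rhs => rw [hs.eq_sqf]
  rw [degree_sqf]

theorem sqf_le_iff {s : Finset τ} {t : τ →₀ ℕ} : sqf s ≤ t ↔ s ⊆ t.support := by
  classical
  constructor
  · intro h k hk
    have := h k
    rw [sqf_apply, if_pos hk] at this
    exact Finsupp.mem_support_iff.2 (by omega)
  · intro h k
    rw [sqf_apply]
    split_ifs with hk
    · exact Nat.one_le_iff_ne_zero.2 (Finsupp.mem_support_iff.1 (h hk))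
    · exact Nat.zero_le _

theorem sqf_disjSum {τ' : Type*} (s : Finset τ) (t : Finset τ') :
    sqf (s.disjSum t) = (sqf s).mapDomain Sum.inl + (sqf t).mapDomain Sum.inr := by
  classical
  ext (k | k)
  · rw [Finsupp.add_apply, Finsupp.mapDomain_apply Sum.inl_injective,
      Finsupp.mapDomain_of_notMem_range _ _ (by simp)]
    simp [sqf_apply]
  · rw [Finsupp.add_apply, Finsupp.mapDomain_apply Sum.inr_injective,
      Finsupp.mapDomain_of_notMem_range _ _ (by simp)]
    simp [sqf_apply]

theorem sqf_empty : sqf (∅ : Finset τ) = 0 := by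
  classical
  ext k
  simp [sqf_apply]

theorem sqf_singleton (k : τ) : sqf {k} = Finsupp.single k 1 := by
  classical
  ext l
  simp [sqf_apply, Finsupp.single_apply, eq_comm]

/-- The ideal generated by the squarefree monomials with supports in `A`. -/
def sqfIdeal (K : Type*) [Field K] (A : Set (Finset τ)) : Ideal (MvPolynomial τ K) :=
  Ideal.span ((fun a => monomial a (1 : K)) '' (sqf '' A))

/-- Squarefree monomial ideals with linear quotients. -/
theorem HasLinRes.sqfIdeal_union {K : Type*} [Field K] {α : Type*} [LinearOrder α] {q : ℕ}
    {b : ℕ → ℕ} {A : Set (Finset τ)} (hA : HasLinRes (sqfIdeal K A) q b)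
    (T : Finset α) (E S : α → Finset τ) (hE : ∀ a ∈ T, (E a).card = q)
    (h₁ : ∀ a ∈ T, ∀ s ∈ A, ∃ k ∈ S a, k ∈ s ∧ k ∉ E a)
    (h₂ : ∀ a ∈ T, ∀ a' ∈ T, a' < a → ∃ k ∈ S a, k ∈ E a' ∧ k ∉ E a)
    (h₃ : ∀ a ∈ T, ∀ k ∈ S a, (∃ s ∈ A, ∀ l ∈ s, l = k ∨ l ∈ E a) ∨
      ∃ a' ∈ T, a' < a ∧ ∀ l ∈ E a', l = k ∨ l ∈ E a) :
    HasLinRes (sqfIdeal K (A ∪ E '' T)) q (fun i => b i + ∑ a ∈ T, (S a).card.choose i) := by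
  classical
  have hlt : ∀ {s t : Finset τ} {k : τ}, k ∈ s → k ∉ t → sqf t k < sqf s k := by
    intro s t k hs ht
    simp [sqf_apply, hs, ht]
  have hle : ∀ {s t : Finset τ} {k : τ}, (∀ l ∈ s, l = k ∨ l ∈ t) →
      sqf s ≤ sqf t + Finsupp.single k 1 := by
    intro s t k h
    rw [sqf_le_iff]
    intro l hl
    rw [Finsupp.mem_support_iff, Finsupp.add_apply, sqf_apply, Finsupp.single_apply]
    rcases h l hl with rfl | h
    · simp
    · simp [h]
  have := HasLinRes.linearQuotients (K := K) hA T (fun a => sqf (E a)) S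
    (fun a ha => (degree_sqf _).trans (hE a ha))
    (by
      rintro a ha _ ⟨s, hs, rfl⟩
      obtain ⟨k, hk, h, h'⟩ := h₁ a ha s hs
      exact ⟨k, hk, hlt h h'⟩)
    (by
      intro a ha a' ha' haa
      obtain ⟨k, hk, h, h'⟩ := h₂ a ha a' ha' haa
      exact ⟨k, hk, hlt h h'⟩)
    (by
      intro a ha k hk
      rcases h₃ a ha k hk with ⟨s, hs, h⟩ | ⟨a', ha', haa, h⟩
      · exact Or.inl ⟨_, ⟨s, hs, rfl⟩, hle h⟩
      · exact Or.inr ⟨a', ha', haa, hle h⟩)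
  rw [sqfIdeal, Set.image_union, Set.image_image]
  exact this

end Squarefree

/-! ### Colon ideals and ranks for the two families of generators -/

section Ranks

variable {n m : ℕ} (K : Type*) [Field K]

/-- The variables that generate the colon ideal of the squarefree monomial with support `a` in the
colexicographic order. -/
def gaps (a : Finset (Fin n)) : Finset (Fin n) := {k | k ∉ a ∧ ∃ l ∈ a, k < l}

theorem exists_mem_notMem_of_card_le {τ : Type*} {s t : Finset τ} (h : t.card ≤ s.card)
    (hne : s ≠ t) : ∃ k ∈ s, k ∉ t := by
  by_contra! hc
  exact hne (Finset.eq_of_subset_of_card_le hc h)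

/-- Colexicographic order gives linear quotients. If `a'` precedes `a` and `k ∈ a' \ a`, some
element of `a \ a'` exceeds `k`, so `k` is a gap of `a`. Conversely, exchanging an element of `a`
for a smaller gap `k` gives an earlier set whose monomial divides `x_a x_k`. -/
theorem hasLinRes_veronese (d : ℕ) :
    HasLinRes (sqfIdeal K {s : Finset (Fin n ⊕ Fin m) |
        ∃ a : Finset (Fin n), a.card = d ∧ s = a.disjSum ∅}) d
      (fun i => ∑ a ∈ Finset.powersetCard d (Finset.univ : Finset (Fin n)),
        (gaps a).card.choose i) := by
  have h0 : HasLinRes (sqfIdeal K (∅ : Set (Finset (Fin n ⊕ Fin m)))) d 0 := by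
    simpa [sqfIdeal] using hasLinRes_bot (σ := Fin n ⊕ Fin m) (K := K) d
  have key := h0.sqfIdeal_union
    ((Finset.powersetCard d (Finset.univ : Finset (Fin n))).map toColex.toEmbedding)
    (fun a => (ofColex a).disjSum ∅) (fun a => (gaps (ofColex a)).disjSum ∅)
    (by
      intro a h₀
      obtain ⟨a, ha, rfl⟩ := Finset.mem_map.1 h₀
      simpa using ha)
    (by simp)
    (by
      intro a h₀ a' h₀' hlt
      obtain ⟨a, ha, rfl⟩ := Finset.mem_map.1 h₀
      obtain ⟨a', ha', rfl⟩ := Finset.mem_map.1 h₀'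
      simp only [Finset.mem_powersetCard_univ] at ha ha'
      obtain ⟨hne, h⟩ := Finset.Colex.toColex_lt_toColex.1 hlt
      obtain ⟨k, hk, hk'⟩ := exists_mem_notMem_of_card_le (ha.trans ha'.symm).le hne
      obtain ⟨l, hl, hl', hkl⟩ := h hk hk'
      have hkl : k < l := lt_of_le_of_ne hkl fun h => hk' (h ▸ hl)
      refine ⟨Sum.inl k, Finset.inl_mem_disjSum.2 ?_, Finset.inl_mem_disjSum.2 hk,
        fun h => hk' (Finset.inl_mem_disjSum.1 h)⟩
      exact Finset.mem_filter.2 ⟨Finset.mem_univ _, hk', l, hl, hkl⟩)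
    (by
      rintro a h₀ (k | k) hk
      · obtain ⟨a, ha, rfl⟩ := Finset.mem_map.1 h₀
        simp only [Finset.mem_powersetCard_univ] at ha
        obtain ⟨-, hka, l, hl, hkl⟩ := Finset.mem_filter.1 (Finset.inl_mem_disjSum.1 hk)
        change k ∉ a at hka
        change l ∈ a at hl
        have hk' : k ∉ a.erase l := fun h => hka (Finset.mem_of_mem_erase h)
        refine Or.inr ⟨toColex (insert k (a.erase l)), Finset.mem_map.2 ⟨_, ?_, rfl⟩, ?_, ?_⟩
        · rw [Finset.mem_powersetCard_univ, Finset.card_insert_of_notMem hk',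
            Finset.card_erase_add_one hl, ha]
        · refine Finset.Colex.toColex_lt_toColex.2 ⟨fun h => hka ?_, fun x hx hxa => ?_⟩
          · rw [← h]
            exact Finset.mem_insert_self _ _
          · have hxk : x = k := (Finset.mem_insert.1 hx).resolve_right
              fun h => hxa (Finset.mem_of_mem_erase h)
            subst hxk
            refine ⟨l, hl, fun h => ?_, hkl.le⟩
            rcases Finset.mem_insert.1 h with h | h
            · exact hkl.ne h.symm
            · exact Finset.notMem_erase _ _ h
        · rintro (x | x) hx
          · rcases Finset.mem_insert.1 (Finset.inl_mem_disjSum.1 hx) with h | h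
            · exact Or.inl (congrArg _ h)
            · exact Or.inr (Finset.inl_mem_disjSum.2 (Finset.mem_of_mem_erase h))
          · simp at hx
      · simp at hk)
  convert key using 2
  · ext s
    simp [eq_comm]
  · simp

/-- Adding the monomials `x_u y_j`, for `u` of size `e` contained in `g j`. -/
theorem hasLinRes_edges (e : ℕ) (g : Fin m → Finset (Fin n)) {b : ℕ → ℕ}
    (hV : HasLinRes (sqfIdeal K {s : Finset (Fin n ⊕ Fin m) |
        ∃ a : Finset (Fin n), a.card = e + 1 ∧ s = a.disjSum ∅}) (e + 1) b) :
    HasLinRes (sqfIdeal K ({s : Finset (Fin n ⊕ Fin m) |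
        ∃ a : Finset (Fin n), a.card = e + 1 ∧ s = a.disjSum ∅} ∪
        {s | ∃ (u : Finset (Fin n)) (j : Fin m), u.card = e ∧ u ⊆ g j ∧ s = u.disjSum {j}}))
      (e + 1)
      (fun i => b i + ∑ u ∈ Finset.powersetCard e (Finset.univ : Finset (Fin n)),
        ∑ j ∈ {j | u ⊆ g j},
          (n - e + (({j' | u ⊆ g j'} : Finset (Fin m)).filter (· < j)).card).choose i) := by
  -- The pairs `(u, j)` are ordered lexicographically. Only the order of `j` for fixed `u` matters:
  -- for `u' ≠ u` of the same size, some `x_k` with `k ∈ u' \ u` is already among the colon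
  -- variables.
  have key := hV.sqfIdeal_union
    (((Finset.powersetCard e (Finset.univ : Finset (Fin n)) ×ˢ
      (Finset.univ : Finset (Fin m))).filter fun p => p.1 ⊆ g p.2).map
        ((Equiv.prodCongr (toColex (α := Finset (Fin n))) (Equiv.refl (Fin m))).trans
          toLex).toEmbedding)
    (fun p => (ofColex (ofLex p).1).disjSum {(ofLex p).2})
    (fun p => (ofColex (ofLex p).1)ᶜ.disjSum
      (({j' | ofColex (ofLex p).1 ⊆ g j'} : Finset (Fin m)).filter (· < (ofLex p).2)))
    (by
      intro a h₀
      obtain ⟨⟨u, j⟩, ha, rfl⟩ := Finset.mem_map.1 h₀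
      simp only [Finset.mem_filter, Finset.mem_product, Finset.mem_powersetCard_univ] at ha
      simpa using ha.1.1)
    (by
      rintro a h₀ _ ⟨v, hv, rfl⟩
      obtain ⟨⟨u, j⟩, ha, rfl⟩ := Finset.mem_map.1 h₀
      simp only [Finset.mem_filter, Finset.mem_product, Finset.mem_powersetCard_univ] at ha
      obtain ⟨k, hk, hk'⟩ := exists_mem_notMem_of_card_le (s := v) (t := u) (by omega) (by
        rintro rfl
        omega)
      exact ⟨Sum.inl k, Finset.inl_mem_disjSum.2 (Finset.mem_compl.2 hk'),
        Finset.inl_mem_disjSum.2 hk, fun h => hk' (Finset.inl_mem_disjSum.1 h)⟩)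
    (by
      intro a h₀ a' h₀' hlt
      obtain ⟨⟨u, j⟩, ha, rfl⟩ := Finset.mem_map.1 h₀
      obtain ⟨⟨u', j'⟩, ha', rfl⟩ := Finset.mem_map.1 h₀'
      simp only [Finset.mem_filter, Finset.mem_product, Finset.mem_powersetCard_univ] at ha ha'
      by_cases huu : u' = u
      · subst huu
        have hj : j' < j := by
          rcases Prod.Lex.lt_iff.1 hlt with h | h
          · exact absurd h (lt_irrefl _)
          · exact h.2
        exact ⟨Sum.inr j', Finset.inr_mem_disjSum.2 (Finset.mem_filter.2
          ⟨Finset.mem_filter.2 ⟨Finset.mem_univ _, ha'.2⟩, hj⟩),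
          Finset.inr_mem_disjSum.2 (Finset.mem_singleton_self _),
          fun h => hj.ne (Finset.mem_singleton.1 (Finset.inr_mem_disjSum.1 h))⟩
      · obtain ⟨k, hk, hk'⟩ := exists_mem_notMem_of_card_le (s := u') (t := u) (by omega) huu
        exact ⟨Sum.inl k, Finset.inl_mem_disjSum.2 (Finset.mem_compl.2 hk'),
          Finset.inl_mem_disjSum.2 hk, fun h => hk' (Finset.inl_mem_disjSum.1 h)⟩)
    (by
      rintro a h₀ (k | k) hk
      · obtain ⟨⟨u, j⟩, ha, rfl⟩ := Finset.mem_map.1 h₀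
        simp only [Finset.mem_filter, Finset.mem_product, Finset.mem_powersetCard_univ] at ha
        have hku : k ∉ u := Finset.mem_compl.1 (Finset.inl_mem_disjSum.1 hk)
        -- For `k ∉ u`, the monomial `x_k x_u` is a pure `x`-generator of degree `e + 1`, hence
        -- already present.
        refine Or.inl ⟨_, ⟨insert k u, ?_, rfl⟩, ?_⟩
        · rw [Finset.card_insert_of_notMem hku, ha.1.1]
        · rintro (x | x) hx
          · rcases Finset.mem_insert.1 (Finset.inl_mem_disjSum.1 hx) with h | h
            · exact Or.inl (congrArg _ h)
            · exact Or.inr (Finset.inl_mem_disjSum.2 h)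
          · simp at hx
      · obtain ⟨⟨u, j⟩, ha, rfl⟩ := Finset.mem_map.1 h₀
        simp only [Finset.mem_filter, Finset.mem_product, Finset.mem_powersetCard_univ] at ha
        obtain ⟨hk, hkj⟩ := Finset.mem_filter.1 (Finset.inr_mem_disjSum.1 hk)
        have huk : u ⊆ g k := (Finset.mem_filter.1 hk).2
        refine Or.inr ⟨toLex (toColex u, k), Finset.mem_map.2 ⟨(u, k), ?_, rfl⟩, ?_, ?_⟩
        · simp [ha.1.1, huk]
        · exact Prod.Lex.lt_iff.2 (Or.inr ⟨rfl, hkj⟩)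
        · rintro (x | x) hx
          · exact Or.inr (Finset.inl_mem_disjSum.2 (Finset.inl_mem_disjSum.1 hx))
          · exact Or.inl (congrArg _ (Finset.mem_singleton.1 (Finset.inr_mem_disjSum.1 hx))))
  convert key using 2 with i
  · congr 1
    ext s
    simp only [Set.mem_ofPred_eq, Set.mem_image, Finset.mem_coe, Finset.mem_map,
      Finset.mem_filter, Finset.mem_product, Finset.mem_powersetCard_univ]
    constructor
    · rintro ⟨u, j, hu, huj, rfl⟩
      exact ⟨_, ⟨(u, j), ⟨⟨hu, Finset.mem_univ _⟩, huj⟩, rfl⟩, rfl⟩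
    · rintro ⟨_, ⟨⟨u, j⟩, ⟨⟨hu, -⟩, huj⟩, rfl⟩, rfl⟩
      exact ⟨u, j, hu, huj, rfl⟩
  · congr 1
    rw [Finset.sum_map, Finset.sum_filter, Finset.sum_product]
    refine Finset.sum_congr rfl fun u hu => ?_
    rw [Finset.mem_powersetCard_univ] at hu
    rw [Finset.sum_filter]
    refine Finset.sum_congr rfl fun j _ => ?_
    congr 1
    rw [Finset.card_disjSum, Finset.card_compl, Fintype.card_fin]
    subst hu
    rfl

end Ranks

/-! ### Binomial sums -/

section Counting

theorem card_gaps_map (n : ℕ) (a : Finset (Fin n)) :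
    (gaps a).card = ((Finset.range n).filter fun k =>
      k ∉ a.map Fin.valEmbedding ∧ ∃ l ∈ a.map Fin.valEmbedding, k < l).card := by
  rw [← Finset.card_map Fin.valEmbedding]
  congr 1
  ext k
  simp only [gaps, Finset.mem_map, Finset.mem_filter, Finset.mem_univ, true_and,
    Finset.mem_range, Fin.valEmbedding_apply]
  constructor
  · rintro ⟨k, ⟨hk, l, hl, hkl⟩, rfl⟩
    exact ⟨k.2, fun ⟨x, hx, hxk⟩ => hk (Fin.ext hxk ▸ hx), _, ⟨l, hl, rfl⟩, hkl⟩
  · rintro ⟨hk, hka, _, ⟨l, hl, rfl⟩, hkl⟩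
    exact ⟨⟨k, hk⟩, ⟨fun h => hka ⟨_, h, rfl⟩, l, hl, hkl⟩, rfl⟩

/-- Split the subsets of `{0, …, n}` by whether they contain `n`. Without `n`, the gaps are those
computed in `{0, …, n - 1}`; with `n`, every one of the `n - e` missing elements is a gap. Pascal's
rule for `n + 1` matches this splitting. -/
theorem sum_choose_card_gaps_range (e i n : ℕ) :
    ∑ a ∈ Finset.powersetCard (e + 1) (Finset.range n),
      ((Finset.range n).filter fun k => k ∉ a ∧ ∃ l ∈ a, k < l).card.choose i =
    (i + e).choose e * n.choose (i + (e + 1)) := by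
  induction n with
  | zero =>
    rw [Nat.choose_eq_zero_of_lt (n := 0) (by omega), mul_zero]
    simp
  | succ n ih =>
    rw [Finset.range_add_one, Finset.powersetCard_succ_insert Finset.notMem_range_self,
      Finset.sum_union, Finset.sum_image]
    · have h₁ : ∀ a ∈ Finset.powersetCard (e + 1) (Finset.range n),
          ((insert n (Finset.range n)).filter fun k => k ∉ a ∧ ∃ l ∈ a, k < l) =
            (Finset.range n).filter fun k => k ∉ a ∧ ∃ l ∈ a, k < l := by
        intro a ha
        rw [Finset.filter_insert, if_neg]
        rintro ⟨-, l, hl, hnl⟩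
        have := Finset.mem_range.1 ((Finset.mem_powersetCard.1 ha).1 hl)
        omega
      have h₂ : ∀ a ∈ Finset.powersetCard e (Finset.range n),
          ((insert n (Finset.range n)).filter fun k =>
            k ∉ insert n a ∧ ∃ l ∈ insert n a, k < l).card = n - e := by
        intro a ha
        obtain ⟨hsub, hcard⟩ := Finset.mem_powersetCard.1 ha
        have : ((insert n (Finset.range n)).filter fun k =>
            k ∉ insert n a ∧ ∃ l ∈ insert n a, k < l) = Finset.range n \ a := by
          ext k
          simp only [Finset.mem_filter, Finset.mem_insert, Finset.mem_range, Finset.mem_sdiff,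
            not_or]
          constructor
          · rintro ⟨hk, ⟨hkn, hka⟩, -⟩
            exact ⟨hk.resolve_left hkn, hka⟩
          · rintro ⟨hk, hka⟩
            exact ⟨Or.inr hk, ⟨hk.ne, hka⟩, n, Or.inl rfl, hk⟩
        rw [this, Finset.card_sdiff_of_subset hsub, Finset.card_range, hcard]
      rw [Finset.sum_congr rfl fun a ha => by rw [h₁ a ha], ih,
        Finset.sum_congr rfl fun a ha => by rw [h₂ a ha], Finset.sum_const,
        Finset.card_powersetCard, Finset.card_range, smul_eq_mul, ← add_assoc,
        Nat.choose_succ_succ n (i + e), mul_add, add_comm]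
      congr 1
      rw [mul_comm ((i + e).choose e)]
      -- Choosing `e` elements and then `i` others amounts to choosing `i + e` and then `e` among
      -- them; when `i + e > n` both counts vanish.
      rcases le_or_gt (i + e) n with h | h
      · rw [Nat.choose_mul (Nat.le_add_left e i)]
        simp
      · rw [Nat.choose_eq_zero_of_lt h, zero_mul]
        rcases le_or_gt e n with h' | h'
        · rw [Nat.choose_eq_zero_of_lt (n := n - e) (by omega), mul_zero]
        · rw [Nat.choose_eq_zero_of_lt h', zero_mul]
    · intro a ha b hb hab
      have ha' : n ∉ a := fun h => Finset.notMem_range_self ((Finset.mem_powersetCard.1 ha).1 h)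
      have hb' : n ∉ b := fun h => Finset.notMem_range_self ((Finset.mem_powersetCard.1 hb).1 h)
      rw [← Finset.erase_insert ha', ← Finset.erase_insert hb', hab]
    · rw [Finset.disjoint_left]
      intro a ha hb
      obtain ⟨b, -, rfl⟩ := Finset.mem_image.1 hb
      exact Finset.notMem_range_self
        ((Finset.mem_powersetCard.1 ha).1 (Finset.mem_insert_self n b))

theorem sum_choose_card_gaps (e i n : ℕ) :
    ∑ a ∈ Finset.powersetCard (e + 1) (Finset.univ : Finset (Fin n)), (gaps a).card.choose i =
    (i + e).choose e * n.choose (i + (e + 1)) := by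
  have hmap : (Finset.univ : Finset (Fin n)).map Fin.valEmbedding = Finset.range n := by
    rw [Fin.map_valEmbedding_univ, Nat.Iio_eq_range]
  rw [← sum_choose_card_gaps_range]
  conv_rhs => rw [← hmap, Finset.powersetCard_map, Finset.sum_map, hmap]
  exact Finset.sum_congr rfl fun a _ => by rw [card_gaps_map]; rfl

/-- Summing over a finite set a function of the rank of the elements. -/
theorem sum_card_filter_lt {α M : Type*} [LinearOrder α] [AddCommMonoid M] (A : Finset α)
    (F : ℕ → M) : ∑ j ∈ A, F (A.filter (· < j)).card = ∑ k ∈ Finset.range A.card, F k := by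
  induction A using Finset.induction_on_max with
  | empty => simp
  | insert a A hmax ih =>
    have ha : a ∉ A := fun h => lt_irrefl _ (hmax a h)
    rw [Finset.sum_insert ha, Finset.card_insert_of_notMem ha, Finset.sum_range_succ, ← ih,
      add_comm]
    congr 1
    · refine Finset.sum_congr rfl fun j hj => ?_
      rw [Finset.filter_insert, if_neg (hmax j hj).not_gt]
    · rw [Finset.filter_insert, if_neg (lt_irrefl a), Finset.filter_true_of_mem hmax]

/-- Grouping by the value of `D` trades a sum over cluster sizes for a sum over the sets `u`, where
the final comparison is made termwise. -/
theorem sum_mul_card_fiber {α : Type*} (U : Finset α) (D : α → ℕ) {m : ℕ}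
    (hD : ∀ u ∈ U, D u ≤ m) (W : ℕ → ℤ) :
    ∑ j ∈ Finset.Icc 2 m, ((U.filter fun u => D u = j).card : ℤ) * W j =
      ∑ u ∈ U, if 2 ≤ D u then W (D u) else 0 := by
  rw [← Finset.sum_filter, ← Finset.sum_fiberwise_of_maps_to (t := Finset.Icc 2 m) (g := D)]
  · refine Finset.sum_congr rfl fun j hj => ?_
    rw [Finset.filter_filter, Finset.sum_congr (g := fun _ => W j) rfl, Finset.sum_const,
      nsmul_eq_mul]
    · congr 3
      ext u
      simp only [Finset.mem_filter]
      have := (Finset.mem_Icc.1 hj).1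
      constructor
      · rintro ⟨h, h'⟩
        exact ⟨h, by omega, h'⟩
      · rintro ⟨h, -, h'⟩
        exact ⟨h, h'⟩
    · intro u hu
      rw [(Finset.mem_filter.1 hu).2.2]
  · intro u hu
    rw [Finset.mem_filter] at hu
    exact Finset.mem_Icc.2 ⟨hu.2, hD u hu.1⟩

/-- This is the contribution of one `u` dividing `D` generators. The factor in parentheses is `1`
for `D ≥ 1` and `0` for `D = 0`: it isolates the summand `k = 0`, and the remaining ones are
reindexed from `2`. -/
theorem sum_range_shift (c : ℕ → ℤ) (N D : ℕ) :
    ∑ k ∈ Finset.range D, c (N + 1 + k) =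
      c (N + 1) * ((D : ℤ) - if 2 ≤ D then (D : ℤ) - 1 else 0) +
        if 2 ≤ D then ∑ k ∈ Finset.Icc 2 D, c (N + k) else 0 := by
  rcases D with _ | _ | D
  · simp
  · simp
  · rw [if_pos (by omega), if_pos (by omega), Finset.sum_range_succ']
    have h : ∑ k ∈ Finset.Icc 2 (D + 1 + 1), c (N + k) =
        ∑ k ∈ Finset.range (D + 1), c (N + 1 + (k + 1)) := by
      rw [← Finset.Ico_add_one_right_eq_Icc, Finset.sum_Ico_eq_sum_range]
      refine Finset.sum_congr (by congr 1) fun k _ => ?_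
      congr 1
      omega
    rw [h]
    push_cast
    ring

/-- Double counting of the pairs `u ⊆ g j`: each `g j` has `e + 1` subsets of size `e`. -/
theorem sum_card_superset {n m : ℕ} (e : ℕ) (g : Fin m → Finset (Fin n))
    (hg : ∀ j, (g j).card = e + 1) :
    ∑ u ∈ Finset.powersetCard e (Finset.univ : Finset (Fin n)),
      ({j | u ⊆ g j} : Finset (Fin m)).card = m * (e + 1) := by
  simp_rw [Finset.card_filter]
  rw [Finset.sum_comm]
  have : ∀ j : Fin m, ∑ u ∈ Finset.powersetCard e (Finset.univ : Finset (Fin n)),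
      (if u ⊆ g j then 1 else 0) = e + 1 := by
    intro j
    rw [← Finset.card_filter]
    have h : ((Finset.powersetCard e (Finset.univ : Finset (Fin n))).filter (· ⊆ g j)) =
        Finset.powersetCard e (g j) := by
      ext u
      simp [Finset.mem_powersetCard, and_comm]
    rw [h, Finset.card_powersetCard, hg, Nat.choose_succ_self_right]
  simp [this]

end Counting

/-! ### Maximal clusters and edges -/

section Clusters

variable {K : Type*} [Field K] {n m e : ℕ} {I : Ideal (MvPolynomial (Fin n) K)}
  {f : Fin m → (Fin n →₀ ℕ)}

/-- Two distinct generators are divided by at most one edge. -/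
theorem eq_of_subset_support (hf : Function.Injective f)
    (hsq : ∀ j, IsSquarefreeMonomial (f j)) (hdeg : ∀ j, (f j).degree = e + 1)
    {u v : Finset (Fin n)} (hu : u.card = e) (hv : v.card = e) {i j : Fin m} (hij : i ≠ j)
    (hui : u ⊆ (f i).support) (huj : u ⊆ (f j).support) (hvi : v ⊆ (f i).support)
    (hvj : v ⊆ (f j).support) : u = v := by
  have hcard : ∀ j, (f j).support.card = e + 1 := fun j => by
    rw [(hsq j).card_support, hdeg]
  have hne : (f i).support ≠ (f j).support := fun h => hij (hf (by
    rw [(hsq i).eq_sqf, (hsq j).eq_sqf, h]))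
  obtain ⟨k, hk, hk'⟩ := exists_mem_notMem_of_card_le
    ((hcard j).trans (hcard i).symm).le hne
  have hint : ((f i).support ∩ (f j).support).card ≤ e := by
    have : ((f i).support ∩ (f j).support) ⊆ (f i).support.erase k := by
      intro x hx
      rw [Finset.mem_inter] at hx
      exact Finset.mem_erase.2 ⟨fun h => hk' (h ▸ hx.2), hx.1⟩
    have h := Finset.card_le_card this
    rw [Finset.card_erase_of_mem hk, hcard] at h
    omega
  rw [Finset.eq_of_subset_of_card_le (Finset.subset_inter hui huj) (hint.trans hu.ge),
    Finset.eq_of_subset_of_card_le (Finset.subset_inter hvi hvj) (hint.trans hv.ge)]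

theorem isEdge_sqf (hfI : Set.range f = minGens I) {u : Finset (Fin n)} (hu : u.card = e)
    {j : Fin m} (hj : u ⊆ (f j).support) : IsEdge I (e + 1) (sqf u) :=
  ⟨isSquarefreeMonomial_sqf u, by rw [degree_sqf, hu],
    f j, hfI ▸ Set.mem_range_self j, sqf_le_iff.2 hj⟩

/-- A maximal cluster with at least two elements consists of all generators divided by an edge. -/
theorem numMaxClusters_eq_card (hf : Function.Injective f) (hfI : Set.range f = minGens I)
    (hsq : ∀ j, IsSquarefreeMonomial (f j)) (hdeg : ∀ j, (f j).degree = e + 1)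
    {j : ℕ} (hj : 2 ≤ j) :
    numMaxClusters I (e + 1) j =
      ((Finset.powersetCard e (Finset.univ : Finset (Fin n))).filter fun u =>
        ({k | u ⊆ (f k).support} : Finset (Fin m)).card = j).card := by
  let A : Finset (Fin n) → Finset (Fin m) := fun u => {k | u ⊆ (f k).support}
  have hA : ∀ u k, k ∈ A u ↔ u ⊆ (f k).support := fun u k => by simp [A]
  have hcardA : ∀ u, ((A u).image f).card = (A u).card := fun u =>
    Finset.card_image_of_injective _ hf
  have hedge : ∀ {v : Fin n →₀ ℕ} {B : Finset (Fin n →₀ ℕ)}, IsEdge I (e + 1) v →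
      (B : Set (Fin n →₀ ℕ)) ⊆ minGens I → (∀ s ∈ B, v ≤ s) →
      v.support.card = e ∧ B ⊆ (A v.support).image f := by
    rintro v B ⟨hv, hvd, -⟩ hB hle
    refine ⟨by rw [hv.card_support]; omega, fun s hs => ?_⟩
    obtain ⟨k, rfl⟩ := hfI.ge (hB hs)
    refine Finset.mem_image_of_mem f ((hA _ _).2 ?_)
    rw [← sqf_le_iff, ← hv.eq_sqf]
    exact hle _ hs
  have hcluster : ∀ {u : Finset (Fin n)} {B : Finset (Fin n →₀ ℕ)}, u.card = e →
      B.Nonempty → B ⊆ (A u).image f → IsCluster I (e + 1) B.card B := by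
    intro u B hu ⟨s, hs⟩ hB
    refine ⟨fun t ht => ?_, rfl, sqf u, ?_, fun t ht => ?_⟩
    · obtain ⟨k, -, rfl⟩ := Finset.mem_image.1 (hB ht)
      exact hfI.le ⟨k, rfl⟩
    · obtain ⟨k, hk, rfl⟩ := Finset.mem_image.1 (hB hs)
      exact isEdge_sqf hfI hu ((hA _ _).1 hk)
    · obtain ⟨k, hk, rfl⟩ := Finset.mem_image.1 (hB ht)
      exact sqf_le_iff.2 ((hA _ _).1 hk)
  -- Here `2 ≤ j` enters: two common generators determine the edge, whereas a single generator is
  -- divisible by several edges when `e ≥ 1`.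
  have huniq : ∀ {u v : Finset (Fin n)}, u.card = e → v.card = e → 2 ≤ (A u).card →
      A u ⊆ A v → u = v := by
    intro u v hu hv h2 huv
    obtain ⟨i, hi, k, hk, hik⟩ := Finset.one_lt_card.1 (show 1 < (A u).card by omega)
    exact eq_of_subset_support hf hsq hdeg hu hv hik ((hA _ _).1 hi) ((hA _ _).1 hk)
      ((hA _ _).1 (huv hi)) ((hA _ _).1 (huv hk))
  have himage : ∀ {u v : Finset (Fin n)}, (A u).image f ⊆ (A v).image f → A u ⊆ A v :=
    fun h => (Finset.image_subset_image_iff hf).1 h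
  have hset : {B : Finset (Fin n →₀ ℕ) | IsCluster I (e + 1) j B ∧
      ¬ ∃ C, IsCluster I (e + 1) (j + 1) C ∧ B ⊆ C} =
      (fun u => (A u).image f) '' ((Finset.powersetCard e
        (Finset.univ : Finset (Fin n))).filter fun u => (A u).card = j : Finset _) := by
    ext B
    simp only [Set.mem_ofPred_eq, Set.mem_image, Finset.mem_coe, Finset.mem_filter,
      Finset.mem_powersetCard_univ]
    constructor
    · rintro ⟨⟨hB, hBj, v, hv, hle⟩, hmax⟩
      obtain ⟨hve, hsub⟩ := hedge hv hB hle
      have heq : B = (A v.support).image f := by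
        by_contra hne
        -- A further generator divided by the same edge would extend `B` to a `(j + 1)`-cluster,
        -- against maximality.
        obtain ⟨s, hs, hsB⟩ := Finset.exists_of_ssubset (hsub.ssubset_of_ne hne)
        have h := hcluster (B := insert s B) hve (Finset.insert_nonempty s B)
          (Finset.insert_subset hs hsub)
        rw [Finset.card_insert_of_notMem hsB, hBj] at h
        exact hmax ⟨_, h, Finset.subset_insert s B⟩
      exact ⟨v.support, ⟨hve, by rw [← hcardA, ← heq, hBj]⟩, heq.symm⟩
    · rintro ⟨u, ⟨hu, huj⟩, rfl⟩
      have hj' : ((A u).image f).card = j := (hcardA u).trans huj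
      refine ⟨?_, ?_⟩
      · have h := hcluster hu (Finset.card_pos.1 (by omega)) (Finset.Subset.refl ((A u).image f))
        rwa [hj'] at h
      · rintro ⟨C, ⟨hC, hCj, v, hv, hle⟩, hsub⟩
        obtain ⟨hve, hCv⟩ := hedge hv hC hle
        -- The edge of a larger cluster `C` must be `u` itself, so `C` has at most `j` elements.
        have huv := huniq hu hve (by omega) (himage (hsub.trans hCv))
        rw [← huv] at hCv
        have := Finset.card_le_card hCv
        omega
  rw [numMaxClusters, hset, Set.InjOn.ncard_image, Set.ncard_coe_finset]
  intro u hu v hv huv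
  simp only [Finset.mem_coe, Finset.mem_filter, Finset.mem_powersetCard_univ] at hu hv
  exact huniq hu.1 hv.1 (by omega) (himage huv.le)

end Clusters

/-! ### The linearization as a squarefree monomial ideal -/

section Linearization

variable {K : Type*} [Field K] {n m e : ℕ} {f : Fin m → (Fin n →₀ ℕ)}

theorem nonempty_minGens {I : Ideal (MvPolynomial (Fin n) K)} (hI : IsMonomialIdeal I)
    (hI0 : I ≠ ⊥) : (minGens I).Nonempty := by
  obtain ⟨S, rfl⟩ := hI
  have hS : S.Nonempty := by
    by_contra h
    rw [Set.not_nonempty_iff_eq_empty] at h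
    exact hI0 (by simp [h])
  obtain ⟨s, hs⟩ := hS
  obtain ⟨t, -, ht⟩ := exists_minimal_le_of_wellFoundedLT
    (fun t : Fin n →₀ ℕ => monomial t (1 : K) ∈
      Ideal.span ((fun s => monomial s (1 : K)) '' S)) s (Ideal.subset_span ⟨s, hs, rfl⟩)
  exact ⟨t, ht⟩

/-- The generator `f j` has positive degree, so some variable occurs in it; with no generator at all
the supremum would be `0`. -/
theorem maxExponent_eq_one (hsq : ∀ j, IsSquarefreeMonomial (f j))
    (hdeg : ∀ j, (f j).degree = e + 1) (j : Fin m) : maxExponent f = 1 := by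
  apply le_antisymm
  · exact Finset.sup_le fun j _ => Finset.sup_le fun k _ => hsq j k
  · have hne : f j ≠ 0 := by
      intro h
      have := hdeg j
      rw [h] at this
      simp at this
    obtain ⟨k, hk⟩ := Finsupp.ne_iff.1 hne
    calc 1 ≤ f j k := Nat.one_le_iff_ne_zero.2 hk
      _ ≤ Finset.univ.sup fun k => f j k :=
        Finset.le_sup (f := fun k => f j k) (Finset.mem_univ k)
      _ ≤ maxExponent f :=
        Finset.le_sup (f := fun j => Finset.univ.sup fun k => f j k) (Finset.mem_univ j)

/-- With exponents bounded by `1`, the complete part consists of the squarefree monomials of degree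
`e + 1`; the supports of the `f_j / x_k` are exactly the `e`-subsets of the support of `f_j`. -/
theorem LIN_eq_sqfIdeal (hsq : ∀ j, IsSquarefreeMonomial (f j))
    (hdeg : ∀ j, (f j).degree = e + 1) (j₀ : Fin m) :
    LIN K (e + 1) f = sqfIdeal K ({s : Finset (Fin n ⊕ Fin m) |
        ∃ a : Finset (Fin n), a.card = e + 1 ∧ s = a.disjSum ∅} ∪
        {s | ∃ (u : Finset (Fin n)) (j : Fin m), u.card = e ∧ u ⊆ (f j).support ∧
          s = u.disjSum {j}}) := by
  have hcard : ∀ j, (f j).support.card = e + 1 := fun j => by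
    rw [(hsq j).card_support, hdeg]
  rw [LIN, completePart, lastPart, sqfIdeal, Set.image_union, Set.image_union, Ideal.span_union,
    maxExponent_eq_one hsq hdeg j₀]
  congr 2
  · ext p
    simp only [Set.mem_ofPred_eq, Set.mem_image]
    constructor
    · rintro ⟨a, ha, ha1, rfl⟩
      have ha1 : IsSquarefreeMonomial a := ha1
      refine ⟨_, ⟨_, ⟨a.support, ha1.card_support.trans ha, rfl⟩, rfl⟩, ?_⟩
      rw [sqf_disjSum, sqf_empty, Finsupp.mapDomain_zero, add_zero, ← ha1.eq_sqf]
    · rintro ⟨_, ⟨_, ⟨a, ha, rfl⟩, rfl⟩, rfl⟩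
      refine ⟨sqf a, by rw [degree_sqf, ha], isSquarefreeMonomial_sqf a, ?_⟩
      rw [sqf_disjSum, sqf_empty, Finsupp.mapDomain_zero, add_zero]
  · have hsub : ∀ j, ∀ k ∈ (f j).support,
        f j - Finsupp.single k 1 = sqf ((f j).support.erase k) := by
      intro j k hk
      ext l
      rw [Finsupp.tsub_apply, sqf_apply, Finsupp.single_apply]
      have := hsq j l
      by_cases hlk : k = l
      · subst hlk
        simp
        omega
      · by_cases hl : f j l = 0
        · simp [hlk, hl]
        · simp [hlk, hl, Ne.symm hlk]
          omega
    ext p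
    simp only [Set.mem_ofPred_eq, Set.mem_image]
    constructor
    · rintro ⟨j, k, hk, rfl⟩
      refine ⟨_, ⟨_, ⟨(f j).support.erase k, j, ?_, Finset.erase_subset _ _, rfl⟩, rfl⟩, ?_⟩
      · rw [Finset.card_erase_of_mem hk, hcard]
        rfl
      · rw [sqf_disjSum, sqf_singleton, Finsupp.mapDomain_single, hsub j k hk]
    · rintro ⟨_, ⟨_, ⟨u, j, hu, huj, rfl⟩, rfl⟩, rfl⟩
      obtain ⟨k, hk, hku⟩ := exists_mem_notMem_of_card_le (s := (f j).support) (t := u)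
        (by rw [hcard]; omega) (by
          rintro rfl
          have := hcard j
          omega)
      refine ⟨j, k, hk, ?_⟩
      have hue : u = (f j).support.erase k := by
        refine Finset.eq_of_subset_of_card_le (Finset.subset_erase.2 ⟨huj, hku⟩) ?_
        rw [Finset.card_erase_of_mem hk, hcard, hu]
        rfl
      rw [sqf_disjSum, sqf_singleton, Finsupp.mapDomain_single, hsub j k hk, hue]

/-- For fixed `u`, the contribution of `y_j` depends only on the rank of `j` among the generators
divisible by `x_u`, so the sum over `j` becomes a sum over an initial range. -/
theorem hasLinRes_LIN (hsq : ∀ j, IsSquarefreeMonomial (f j))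
    (hdeg : ∀ j, (f j).degree = e + 1) (j₀ : Fin m) :
    HasLinRes (LIN K (e + 1) f) (e + 1) (fun i => (i + e).choose e * n.choose (i + (e + 1)) +
      ∑ u ∈ Finset.powersetCard e (Finset.univ : Finset (Fin n)),
        ∑ k ∈ Finset.range ({j | u ⊆ (f j).support} : Finset (Fin m)).card,
          (n - e + k).choose i) := by
  rw [LIN_eq_sqfIdeal hsq hdeg j₀]
  convert hasLinRes_edges K e (fun j => (f j).support) (hasLinRes_veronese K (e + 1))
    using 2 with i
  rw [sum_choose_card_gaps]
  congr 1
  refine Finset.sum_congr rfl fun u _ => ?_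
  exact (sum_card_filter_lt _ fun k => (n - e + k).choose i).symm

end Linearization

end StarLinearization

end

/-! ### The Betti numbers of the linearization -/

open StarLinearization in
/-- `I` is a nonzero squarefree monomial ideal of `K[x₁, …, xₙ]` with minimal monomial generators
`f 0, …, f (m - 1)`, all of degree `d ≥ 1`. The ideal `LIN(I)` has a minimal graded free
resolution, and in each of them the `i`-th total Betti number is the given one. Sums over `j ≥ 2`
stop at `m`, since a set of generators has at most `m` elements. -/
theorem corollary4p8 {K : Type*} [Field K] {n m d : ℕ} (hd : 1 ≤ d)
    (I : Ideal (MvPolynomial (Fin n) K)) (hI : IsMonomialIdeal I) (hI0 : I ≠ ⊥)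
    (f : Fin m → (Fin n →₀ ℕ)) (hf : Function.Injective f) (hfI : Set.range f = minGens I)
    (hsq : ∀ s ∈ minGens I, IsSquarefreeMonomial s)
    (hdeg : ∀ s ∈ minGens I, s.degree = d) :
    Nonempty (MinimalGradedFreeResolution (LIN K d f)) ∧
    ∀ (F : MinimalGradedFreeResolution (LIN K d f)) (i : ℕ),
      (F.totalBetti i : ℤ) =
        ((i + d - 1).choose (d - 1) : ℤ) * (n.choose (i + d) : ℤ)
        + ((n - d + 1).choose i : ℤ) *
            ((m : ℤ) * d - ∑ j ∈ Finset.Icc 2 m, ((j : ℤ) - 1) * (numMaxClusters I d j : ℤ))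
        + ∑ j ∈ Finset.Icc 2 m, (numMaxClusters I d j : ℤ) *
            ∑ k ∈ Finset.Icc 2 j, ((n - d + k).choose i : ℤ) := by
  obtain ⟨e, rfl⟩ : ∃ e, d = e + 1 := ⟨d - 1, by omega⟩
  have hsq' : ∀ j, IsSquarefreeMonomial (f j) := fun j => hsq _ (hfI.le ⟨j, rfl⟩)
  have hdeg' : ∀ j, (f j).degree = e + 1 := fun j => hdeg _ (hfI.le ⟨j, rfl⟩)
  obtain ⟨s, hs⟩ := nonempty_minGens hI hI0
  obtain ⟨j₀, -⟩ := hfI.ge hs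
  have hcard : ∀ j, (f j).support.card = e + 1 := fun j => by
    rw [(hsq' j).card_support, hdeg']
  -- Needed for the truncated subtraction: `n - (e + 1) + 1 = n - e` fails if `n ≤ e`.
  have hn : e + 1 ≤ n := by
    have := Finset.card_le_univ (f j₀).support
    rwa [hcard, Fintype.card_fin] at this
  obtain ⟨hne, hbetti⟩ := (hasLinRes_LIN (K := K) hsq' hdeg' j₀).nonempty_and_totalBetti
  refine ⟨hne, fun F i => ?_⟩
  have hC : ∀ j ∈ Finset.Icc 2 m, numMaxClusters I (e + 1) j = _ := fun j hj =>
    numMaxClusters_eq_card hf hfI hsq' hdeg' (Finset.mem_Icc.1 hj).1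
  have hD : ∀ u ∈ Finset.powersetCard e (Finset.univ : Finset (Fin n)),
      ({j | u ⊆ (f j).support} : Finset (Fin m)).card ≤ m := fun u _ =>
    (Finset.card_le_univ _).trans (Fintype.card_fin m).le
  have h₁ : ∑ j ∈ Finset.Icc 2 m, ((j : ℤ) - 1) * (numMaxClusters I (e + 1) j : ℤ) = _ :=
    (Finset.sum_congr rfl fun j hj => by rw [hC j hj, mul_comm]).trans
      (sum_mul_card_fiber _ _ hD fun j => (j : ℤ) - 1)
  have h₂ : ∑ j ∈ Finset.Icc 2 m, (numMaxClusters I (e + 1) j : ℤ) *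
      ∑ k ∈ Finset.Icc 2 j, ((n - (e + 1) + k).choose i : ℤ) = _ :=
    (Finset.sum_congr rfl fun j hj => by rw [hC j hj]).trans
      (sum_mul_card_fiber _ _ hD fun j => ∑ k ∈ Finset.Icc 2 j, ((n - (e + 1) + k).choose i : ℤ))
  have h₃ : (m : ℤ) * ((e + 1 : ℕ) : ℤ) =
      ∑ u ∈ Finset.powersetCard e (Finset.univ : Finset (Fin n)),
        (({j | u ⊆ (f j).support} : Finset (Fin m)).card : ℤ) := by
    rw [← Nat.cast_mul, ← sum_card_superset e (fun j => (f j).support) hcard, Nat.cast_sum]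
  -- Everything but the first term is now a sum over all `u` of size `e`; those dividing no
  -- generator contribute zero on both sides.
  rw [hbetti, h₁, h₂, h₃, ← Finset.sum_sub_distrib, Finset.mul_sum, add_assoc,
    ← Finset.sum_add_distrib, Nat.cast_add, Nat.cast_mul, Nat.cast_sum]
  congr 1
  refine Finset.sum_congr rfl fun u _ => ?_
  rw [← sum_range_shift (fun k => (k.choose i : ℤ)), Nat.cast_sum,
    show n - (e + 1) + 1 = n - e by omega]
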